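/- Let $X,Y,Z$ be smooth paracompact Hausdorff manifolds (without boundary) of dimensions $n,m,l$, and let $I=(0,1]$. "Chart" means any chart of the maximal smooth atlas, and $A\subset\subset B$ means that $A$ is a compact subset of $B$. A net $(u_\varepsilon)_{\varepsilon\in I}$ of smooth maps $X\to Y$ belongs to $\mathcal E_M[X,Y]$ if (i) for every compact $K\subseteq X$ there are $\varepsilon_0>0$ and a compact $K'\subseteq Y$ with $u_\varepsilon(K)\subseteq K'$ for all $\varepsilon<\varepsilon_0$; and (ii) for every integer $k\ge1$, all charts $(V,\varphi)$ of $X$ and $(W,\psi)$ of $Y$, and all $L\subset\subset V$, $L'\subset\subset W$, there is $N\in\mathbb N$ with $$\sup_{p\in L\cap u_\varepsilon^{-1}(L')}\big\|D^{(k)}(\psi\circ u_\varepsilon\circ\varphi^{-1})(\varphi(p))\big\|=O(\varepsilon^{-N})\qquad(\varepsilon\to0),$$ where a supremum over the empty set is $0$. For $(u_\varepsilon)_\varepsilon,(v_\varepsilon)_\varepsilon\in\mathcal E_M[X,Y]$ write $(u_\varepsilon)_\varepsilon\sim(v_\varepsilon)_\varepsilon$ if (i) for some (equivalently, every) Riemannian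 metric $h$ on $Y$ with induced distance $d_h$ (equal to $\infty$ between different components), $\sup_{p\in K}d_h(u_\varepsilon(p),v_\varepsilon(p))\to0$ as $\varepsilon\to0$ for every compact $K\subseteq X$; and (ii) for all integers $k\ge0$ and $q\ge0$, all charts $(V,\varphi)$ of $X$ and $(W,\psi)$ of $Y$, and all $L\subset\subset V$, $L'\subset\subset W$, $$\sup_{p\in L\cap u_\varepsilon^{-1}(L')\cap v_\varepsilon^{-1}(L')}\big\|D^{(k)}(\psi\circ u_\varepsilon\circ\varphi^{-1}-\psi\circ v_\varepsilon\circ\varphi^{-1})(\varphi(p))\big\|=O(\varepsilon^{q})\qquad(\varepsilon\to0).$$ Let $\mathcal G[X,Y]:=\mathcal E_M[X,Y]/\!\sim$, and write $\mathrm{cl}[(u_\varepsilon)_\varepsilon]$ for the class of $(u_\varepsilon)_\varepsilon$. **Theorem.** Let $u\in\mathcal G[X,Y]$ and $v\in\mathcal G[Y,Z]$, and suppose that some representative $(v_\varepsilon)_\varepsilon$ of $v$ satisfies: for every compact $K\subseteq Y$ there are $\varepsilon_0>0$ and a chart $(W,\psi)$ of $Z$ such that $$\overline{\bigcup_{\varepsilon<\varepsilon_0}v_\varepsilon(K)}\subset\subset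 W.$$ Then $v\circ u:=\mathrm{cl}[(v_\varepsilon\circ u_\varepsilon)_\varepsilon]$ is a well-defined element of $\mathcal G[X,Z]$. That is, for all representatives $(u_\varepsilon)_\varepsilon,(u'_\varepsilon)_\varepsilon$ of $u$ and $(v_\varepsilon)_\varepsilon,(v'_\varepsilon)_\varepsilon$ of $v$, the net $(v_\varepsilon\circ u_\varepsilon)_\varepsilon$ belongs to $\mathcal E_M[X,Z]$ and $(v_\varepsilon\circ u_\varepsilon)_\varepsilon\sim(v'_\varepsilon\circ u'_\varepsilon)_\varepsilon$; hence there is exactly one element of $\mathcal G[X,Z]$ that is the class of all these composites. -/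

import Mathlib

open scoped Manifold ContDiff Topology ENNReal Bundle

namespace Colombeau

/-- The parameter interval `I = (0, 1]`. -/
abbrev ParamInterval : Type := Set.Ioc (0 : ℝ) 1

/-- Nets `(u_ε)_{ε ∈ (0, 1]}` of smooth maps from `X` (of dimension `n`) to `Y`
(of dimension `m`). -/
abbrev SmoothNet (n m : ℕ)
    (X : Type*) [TopologicalSpace X] [ChartedSpace (EuclideanSpace ℝ (Fin n)) X]
    (Y : Type*) [TopologicalSpace Y] [ChartedSpace (EuclideanSpace ℝ (Fin m)) Y] : Type _ :=
  ParamInterval → ContMDiffMap (𝓡 n) (𝓡 m) X Y ∞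

/-- The charts of the smooth manifold `X`: all members of its maximal smooth atlas. -/
abbrev SmoothCharts (n : ℕ)
    (X : Type*) [TopologicalSpace X] [ChartedSpace (EuclideanSpace ℝ (Fin n)) X] :
    Set (OpenPartialHomeomorph X (EuclideanSpace ℝ (Fin n))) :=
  IsManifold.maximalAtlas (𝓡 n) ∞ X

/-- The (extended) distance on `Y` induced by a smooth Riemannian metric `h`: the infimum of
the `h`-lengths of paths, which is `∞` for points in different components. -/
noncomputable def metricDist {m : ℕ}
    {Y : Type*} [TopologicalSpace Y] [ChartedSpace (EuclideanSpace ℝ (Fin m)) Y]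
    [IsManifold (𝓡 m) ∞ Y]
    (h : Bundle.ContMDiffRiemannianMetric (𝓡 m) ∞ (EuclideanSpace ℝ (Fin m))
      (fun y : Y => TangentSpace (𝓡 m) y))
    (y z : Y) : ℝ≥0∞ :=
  letI : Bundle.RiemannianBundle (fun y : Y => TangentSpace (𝓡 m) y) := ⟨h.toRiemannianMetric⟩
  Manifold.riemannianEDist (𝓡 m) y z

section Nets

variable {n m : ℕ}
  {X : Type*} [TopologicalSpace X] [ChartedSpace (EuclideanSpace ℝ (Fin n)) X]
  {Y : Type*} [TopologicalSpace Y] [ChartedSpace (EuclideanSpace ℝ (Fin m)) Y]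

/-- c-boundedness: for small `ε`, all `u_ε` map a given compact set into one compact set. -/
def IsCBounded (u : SmoothNet n m X Y) : Prop :=
  ∀ K : Set X, IsCompact K →
    ∃ ε₀ : ℝ, 0 < ε₀ ∧ ∃ K' : Set Y, IsCompact K' ∧
      ∀ ε : ParamInterval, (ε : ℝ) < ε₀ → u ε '' K ⊆ K'

/-- The net belongs to `𝓔_M[X, Y]`: it is c-bounded and all derivatives of order at least `1`
of its chart expressions grow at most like a power of `1/ε`, on compact subsets of the
chart domains. -/
def IsModerate (u : SmoothNet n m X Y) : Prop :=
  IsCBounded u ∧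
  ∀ k : ℕ, 1 ≤ k →
    ∀ φ ∈ SmoothCharts n X, ∀ ψ ∈ SmoothCharts m Y,
    ∀ L : Set X, IsCompact L → L ⊆ φ.source →
    ∀ L' : Set Y, IsCompact L' → L' ⊆ ψ.source →
      ∃ N : ℕ, ∃ ε₁ : ℝ, 0 < ε₁ ∧ ∃ C : ℝ, 0 < C ∧
        ∀ ε : ParamInterval, (ε : ℝ) < ε₁ →
          ∀ p ∈ L, u ε p ∈ L' →
            ‖iteratedFDeriv ℝ k (fun x => ψ (u ε (φ.symm x))) (φ p)‖ ≤ C * ((ε : ℝ) ^ N)⁻¹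

/-- The relation `(u_ε) ∼ (v_ε)`: uniform convergence to `0` on compact sets of the distance
for some Riemannian metric on the target, and rapid decay of all derivatives (including those
of order `0`) of differences of chart expressions. -/
def IsEquivalent [IsManifold (𝓡 m) ∞ Y] (u v : SmoothNet n m X Y) : Prop :=
  (∃ h : Bundle.ContMDiffRiemannianMetric (𝓡 m) ∞ (EuclideanSpace ℝ (Fin m))
      (fun y : Y => TangentSpace (𝓡 m) y),
    ∀ K : Set X, IsCompact K →
      Filter.Tendsto (fun ε : ParamInterval => ⨆ p ∈ K, metricDist h (u ε p) (v ε p))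
        (Filter.comap (fun ε : ParamInterval => (ε : ℝ)) (𝓝 0)) (𝓝 0)) ∧
  ∀ k : ℕ, ∀ q : ℕ,
    ∀ φ ∈ SmoothCharts n X, ∀ ψ ∈ SmoothCharts m Y,
    ∀ L : Set X, IsCompact L → L ⊆ φ.source →
    ∀ L' : Set Y, IsCompact L' → L' ⊆ ψ.source →
      ∃ ε₁ : ℝ, 0 < ε₁ ∧ ∃ C : ℝ, 0 < C ∧
        ∀ ε : ParamInterval, (ε : ℝ) < ε₁ →
          ∀ p ∈ L, u ε p ∈ L' → v ε p ∈ L' →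
            ‖iteratedFDeriv ℝ k
              (fun x => ψ (u ε (φ.symm x)) - ψ (v ε (φ.symm x))) (φ p)‖ ≤ C * (ε : ℝ) ^ q

/-- For each compact `K` there are `ε₀ > 0` and a chart of `Y` whose domain contains, as a
compact subset, the closure of the union of the sets `u_ε(K)` with `ε < ε₀`. -/
def HasSingleChartImages (u : SmoothNet n m X Y) : Prop :=
  ∀ K : Set X, IsCompact K →
    ∃ ε₀ : ℝ, 0 < ε₀ ∧ ∃ ψ ∈ SmoothCharts m Y,
      IsCompact (closure (⋃ ε : {ε : ParamInterval // (ε : ℝ) < ε₀}, u ε.1 '' K)) ∧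
      closure (⋃ ε : {ε : ParamInterval // (ε : ℝ) < ε₀}, u ε.1 '' K) ⊆ ψ.source

end Nets

/-- The componentwise composition `(v_ε ∘ u_ε)_ε`. -/
noncomputable def compNet {n m l : ℕ}
    {X : Type*} [TopologicalSpace X] [ChartedSpace (EuclideanSpace ℝ (Fin n)) X]
    {Y : Type*} [TopologicalSpace Y] [ChartedSpace (EuclideanSpace ℝ (Fin m)) Y]
    {Z : Type*} [TopologicalSpace Z] [ChartedSpace (EuclideanSpace ℝ (Fin l)) Z]
    (v : SmoothNet m l Y Z) (u : SmoothNet n m X Y) : SmoothNet n l X Z :=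
  fun ε => (v ε).comp (u ε)

/-- The space `𝓔_M[X, Y]` of c-bounded moderate nets. -/
def ModerateNet (n m : ℕ)
    (X : Type*) [TopologicalSpace X] [ChartedSpace (EuclideanSpace ℝ (Fin n)) X]
    (Y : Type*) [TopologicalSpace Y] [ChartedSpace (EuclideanSpace ℝ (Fin m)) Y] : Type _ :=
  {u : SmoothNet n m X Y // IsModerate u}

/-- The space `𝓖[X, Y] = 𝓔_M[X, Y] / ∼` of c-bounded generalized functions. -/
def GenMap (n m : ℕ)
    (X : Type*) [TopologicalSpace X] [ChartedSpace (EuclideanSpace ℝ (Fin n)) X]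
    (Y : Type*) [TopologicalSpace Y] [ChartedSpace (EuclideanSpace ℝ (Fin m)) Y]
    [IsManifold (𝓡 m) ∞ Y] : Type _ :=
  Quot (fun u v : ModerateNet n m X Y => IsEquivalent u.1 v.1)

/-- The class `cl[(u_ε)_ε]` of a moderate net. -/
def GenMap.cl {n m : ℕ}
    {X : Type*} [TopologicalSpace X] [ChartedSpace (EuclideanSpace ℝ (Fin n)) X]
    {Y : Type*} [TopologicalSpace Y] [ChartedSpace (EuclideanSpace ℝ (Fin m)) Y]
    [IsManifold (𝓡 m) ∞ Y] (u : ModerateNet n m X Y) : GenMap n m X Y :=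
  Quot.mk _ u

end Colombeau

section PartitionOfUnity

universe uM

open Set Function

variable {E : Type*} [NormedAddCommGroup E] [NormedSpace ℝ E] [FiniteDimensional ℝ E]
  {H : Type*} [TopologicalSpace H] (I : ModelWithCorners ℝ E H)
  {M : Type uM} [TopologicalSpace M] [ChartedSpace H M] [T2Space M] [ParacompactSpace M]

/-- On a paracompact Hausdorff manifold, every neighbourhood assignment admits a subordinate
smooth bump covering. -/
theorem SmoothBumpCovering.exists_isSubordinate_of_paracompact {U : M → Set M}
    (hU : ∀ x, U x ∈ 𝓝 x) :
    ∃ (ι : Type uM) (f : SmoothBumpCovering ι I M univ), ∀ i, ∃ x, tsupport (f i) ⊆ U x := by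
  have : LocallyCompactSpace H := I.locallyCompactSpace
  have : LocallyCompactSpace M := ChartedSpace.locallyCompactSpace H M
  have hW : ∀ x, ∃ W : Set M, IsOpen W ∧ x ∈ W ∧ W ⊆ U x ∧ IsCompact (closure W) := fun x => by
    obtain ⟨K, hK, hxK, hKU⟩ := exists_compact_subset isOpen_interior
      (mem_interior_iff_mem_nhds.2 (hU x))
    exact ⟨interior K, isOpen_interior, hxK, interior_subset.trans (hKU.trans interior_subset),
      hK.of_isClosed_subset isClosed_closure (closure_minimal interior_subset hK.isClosed)⟩
  choose W hWo hxW hWU hWc using hW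
  obtain ⟨V, hVo, hVc, hVf, hVW⟩ := precise_refinement W hWo
    (iUnion_eq_univ_iff.2 fun x => ⟨x, hxW x⟩)
  obtain ⟨V', hV'c, -, hV'V⟩ := exists_iUnion_eq_closure_subset hVo (fun x => hVf.point_finite x) hVc
  have hK : ∀ x, IsCompact (closure (V' x)) := fun x =>
    (hWc x).of_isClosed_subset isClosed_closure (closure_mono
      ((subset_closure.trans (hV'V x)).trans (hVW x)))
  have hb : ∀ x (y : closure (V' x)), ∃ f : SmoothBumpFunction I y.1, tsupport f ⊆ V x :=
    fun x y => by
      obtain ⟨f, -, hf⟩ := (SmoothBumpFunction.nhds_basis_tsupport (I := I) y.1).mem_iff.1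
        ((hVo x).mem_nhds (hV'V x y.2))
      exact ⟨f, hf⟩
  choose b hb using hb
  have hT := fun x => (hK x).elim_nhds_subcover' (fun y hy => {z | b x ⟨y, hy⟩ =ᶠ[𝓝 z] 1})
    (fun y hy => (b x ⟨y, hy⟩).eventuallyEq_one.eventuallyEq_nhds)
  choose T hT using hT
  refine ⟨Σ x, T x, ⟨fun i => i.2.1.1, fun i => b i.1 i.2.1, fun _ => mem_univ _, ?_, ?_⟩,
    fun i => ⟨i.1, (hb _ _).trans ((hVW _).trans (hWU _))⟩⟩
  · intro z
    obtain ⟨N, hN, hfin⟩ := hVf z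
    refine ⟨N, hN, (hfin.biUnion fun x _ => finite_range fun y : T x => (⟨x, y⟩ : Σ x, T x)).subset
      fun i hi => ?_⟩
    refine mem_iUnion₂.2 ⟨i.1, ?_, i.2, rfl⟩
    exact hi.mono (inter_subset_inter_left _ (subset_closure.trans (hb _ _)))
  · intro z _
    obtain ⟨x, hx⟩ := iUnion_eq_univ_iff.1 hV'c z
    obtain ⟨y, hy, hzy⟩ := mem_iUnion₂.1 (hT x (subset_closure hx))
    exact ⟨⟨x, y, hy⟩, hzy⟩

variable [IsManifold I ∞ M]

/-- Existence of smooth partitions of unity subordinate to a neighbourhood assignment on a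
paracompact Hausdorff manifold. -/
theorem SmoothPartitionOfUnity.exists_subordinate_of_paracompact {U : M → Set M}
    (hU : ∀ x, U x ∈ 𝓝 x) :
    ∃ (ι : Type uM) (ρ : SmoothPartitionOfUnity ι I M univ), ∀ i, ∃ x, tsupport (ρ i) ⊆ U x := by
  obtain ⟨ι, f, hf⟩ := SmoothBumpCovering.exists_isSubordinate_of_paracompact I hU
  refine ⟨ι, f.toSmoothPartitionOfUnity, fun i => (hf i).imp fun x hx => ?_⟩
  exact (closure_mono (f.support_toSmoothPartitionOfUnity_subset i)).trans hx

open Bundle in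
/-- Local sections with values in convex sets can be glued on paracompact Hausdorff manifolds. -/
theorem exists_contMDiff_section_forall_mem_convex_of_paracompact
    {F : Type*} [NormedAddCommGroup F] [NormedSpace ℝ F]
    (V : M → Type*) [∀ x, AddCommGroup (V x)] [∀ x, TopologicalSpace (V x)] [∀ x, Module ℝ (V x)]
    [TopologicalSpace (TotalSpace F V)] [FiberBundle F V] [VectorBundle ℝ F V]
    (t : ∀ x, Set (V x)) (ht : ∀ x, Convex ℝ (t x))
    (hloc : ∀ x₀ : M, ∃ U ∈ 𝓝 x₀, ∃ s : (x : M) → V x,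
      ContMDiffOn I (I.prod 𝓘(ℝ, F)) ∞ (fun x => TotalSpace.mk' F x (s x)) U ∧
        ∀ y ∈ U, s y ∈ t y) :
    ∃ s : (x : M) → V x, ContMDiff I (I.prod 𝓘(ℝ, F)) ∞ (fun x => TotalSpace.mk' F x (s x)) ∧
      ∀ x, s x ∈ t x := by
  choose W hW s hs hst using hloc
  obtain ⟨ι, ρ, hρ⟩ := SmoothPartitionOfUnity.exists_subordinate_of_paracompact I
    (fun x => interior_mem_nhds.2 (hW x))
  choose c hc using hρ
  refine ⟨fun x => ∑ᶠ j, ρ j x • s (c j) x, ?_, fun x => ?_⟩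
  · have h (j : ι) : ContMDiff I (I.prod 𝓘(ℝ, F)) ∞
        (fun x => TotalSpace.mk' F x (ρ j x • s (c j) x)) :=
      ContMDiffOn.smul_section_of_tsupport (ρ j).contMDiff.contMDiffOn isOpen_interior (hc j)
        ((hs (c j)).mono interior_subset)
    refine ContMDiff.finsum_section_of_locallyFinite ?_ h
    refine ρ.locallyFinite.subset fun i x hx => ?_
    exact left_ne_zero_of_smul hx
  · refine (ht x).finsum_mem (ρ.nonneg · x) (ρ.sum_eq_one (mem_univ x)) fun j hj => ?_
    exact hst _ x (interior_subset (hc j (subset_closure hj)))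

end PartitionOfUnity

section RiemannianMetric

open Bundle Bornology

/-- The sublevel set of a positive definite bilinear form on a finite-dimensional space is
bounded. -/
theorem isVonNBounded_setOf_bilinear_lt_one {E : Type*} [NormedAddCommGroup E] [NormedSpace ℝ E]
    [FiniteDimensional ℝ E] (g : E →L[ℝ] E →L[ℝ] ℝ) (hg : ∀ v, v ≠ 0 → 0 < g v v) :
    IsVonNBounded ℝ {v : E | g v v < 1} := by
  have : ProperSpace E := FiniteDimensional.proper ℝ E
  rw [NormedSpace.isVonNBounded_iff]
  rcases (Metric.sphere (0 : E) 1).eq_empty_or_nonempty with h | h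
  · refine (Metric.isBounded_closedBall (x := (0 : E)) (r := 1)).subset fun v _ => ?_
    by_contra hv
    have hv0 : v ≠ 0 := fun h0 => hv (by simp [h0])
    have : (‖v‖⁻¹ • v) ∈ Metric.sphere (0 : E) 1 := by
      simp [norm_smul, norm_ne_zero_iff.2 hv0]
    simp [h] at this
  · obtain ⟨w, hw, hmin⟩ := (isCompact_sphere (0 : E) 1).exists_isMinOn h
      (f := fun v => g v v) (g.continuous.clm_apply continuous_id).continuousOn
    have hw0 : w ≠ 0 := by
      rintro rfl
      simp at hw
    have hc := hg w hw0
    set c := g w w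
    refine (Metric.isBounded_closedBall (x := (0 : E)) (r := 1 / c + 1)).subset fun v hv => ?_
    rcases eq_or_ne v 0 with rfl | hv0
    · simpa using by positivity
    have hn : 0 < ‖v‖ := norm_pos_iff.2 hv0
    have h1 : c ≤ g (‖v‖⁻¹ • v) (‖v‖⁻¹ • v) := hmin (by simp [norm_smul, hn.ne'])
    have h2 : c * ‖v‖ ^ 2 < 1 := by
      have h3 : g (‖v‖⁻¹ • v) (‖v‖⁻¹ • v) * ‖v‖ ^ 2 = g v v := by
        simp only [map_smul, smul_apply, smul_eq_mul]
        field_simp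
      have := mul_le_mul_of_nonneg_right h1 (sq_nonneg ‖v‖)
      rw [h3] at this
      exact this.trans_lt hv
    rw [mem_closedBall_zero_iff]
    have h4 : ‖v‖ ^ 2 < 1 / c := by rwa [lt_div_iff₀ hc, mul_comm]
    nlinarith [sq_nonneg (‖v‖ - 1), one_div_pos.2 hc]

set_option synthInstance.maxHeartbeats 200000 in
set_option maxHeartbeats 1000000 in
/-- Every paracompact Hausdorff manifold carries a smooth Riemannian metric. -/
theorem nonempty_contMDiffRiemannianMetric {E : Type*} [NormedAddCommGroup E]
    [InnerProductSpace ℝ E] [FiniteDimensional ℝ E]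
    (M : Type*) [TopologicalSpace M] [ChartedSpace E M] [T2Space M] [ParacompactSpace M]
    [IsManifold 𝓘(ℝ, E) ∞ M] :
    Nonempty (ContMDiffRiemannianMetric 𝓘(ℝ, E) ∞ E (fun y : M => TangentSpace 𝓘(ℝ, E) y)) := by
  let t : ∀ y : M, Set (TangentSpace 𝓘(ℝ, E) y →L[ℝ] TangentSpace 𝓘(ℝ, E) y →L[ℝ] ℝ) :=
    fun y => {g | (∀ v w, g v w = g w v) ∧ ∀ v, v ≠ 0 → 0 < g v v}
  suffices h : ∃ g : (y : M) → TangentSpace 𝓘(ℝ, E) y →L[ℝ] TangentSpace 𝓘(ℝ, E) y →L[ℝ] ℝ,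
      ContMDiff 𝓘(ℝ, E) (𝓘(ℝ, E).prod 𝓘(ℝ, E →L[ℝ] E →L[ℝ] ℝ)) ∞
        (fun y => TotalSpace.mk' (E →L[ℝ] E →L[ℝ] ℝ) y (g y)) ∧ ∀ y, g y ∈ t y by
    obtain ⟨g, hg, hgt⟩ := h
    exact ⟨⟨g, fun b => (hgt b).1, fun b => (hgt b).2,
      fun b => isVonNBounded_setOf_bilinear_lt_one (E := E) (g b) (hgt b).2, hg⟩⟩
  refine exists_contMDiff_section_forall_mem_convex_of_paracompact 𝓘(ℝ, E) _ t ?_ ?_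
  · rintro y a ⟨ha, ha'⟩ b ⟨hb, hb'⟩ s r hs hr hsr
    refine ⟨fun v w => ?_, fun v hv => ?_⟩
    · simp only [add_apply, smul_apply, ha v w, hb v w]
    · have h1 := ha' v hv
      have h2 := hb' v hv
      simp only [add_apply, smul_apply, smul_eq_mul]
      rcases hs.eq_or_lt with rfl | hs
      · obtain rfl : r = 1 := by linarith
        simpa using h2
      · exact add_pos_of_pos_of_nonneg (mul_pos hs h1) (mul_nonneg hr h2.le)
  · intro x₀
    let e := trivializationAt E (fun y : M => TangentSpace 𝓘(ℝ, E) y) x₀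
    let e' := trivializationAt (E →L[ℝ] E →L[ℝ] ℝ)
      (fun y : M => TangentSpace 𝓘(ℝ, E) y →L[ℝ] TangentSpace 𝓘(ℝ, E) y →L[ℝ] ℝ) x₀
    obtain ⟨B, hB⟩ : ∃ B : E →L[ℝ] E →L[ℝ] ℝ, ∀ v w, B v w = inner ℝ v w :=
      ⟨innerSL ℝ, fun _ _ => rfl⟩
    let T (y : M) : TangentSpace 𝓘(ℝ, E) y →L[ℝ] E := e.continuousLinearMapAt ℝ y
    let s (y : M) : TangentSpace 𝓘(ℝ, E) y →L[ℝ] TangentSpace 𝓘(ℝ, E) y →L[ℝ] ℝ :=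
      (ContinuousLinearMap.precomp ℝ (T y)).comp (B.comp (T y))
    have hs : ∀ y v w, s y v w = B (T y v) (T y w) := fun y v w => rfl
    refine ⟨e.baseSet, e.open_baseSet.mem_nhds (FiberBundle.mem_baseSet_trivializationAt' x₀),
      s, ?_, fun y hy => ⟨fun v w => ?_, fun v hv => ?_⟩⟩
    · have hb : e.baseSet ⊆ e'.baseSet := fun y hy => ⟨hy, hy, Set.mem_univ _⟩
      rw [e'.contMDiffOn_section_iff e.open_baseSet hb]
      refine (contMDiffOn_const (c := B)).congr fun y hy => ?_
      ext v w
      have := inCoordinates_apply_eq₂ (𝕜 := ℝ) (x₀ := x₀) (x := y)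
        (F₁ := E) (F₂ := E) (F₃ := ℝ) (E₁ := fun y : M => TangentSpace 𝓘(ℝ, E) y)
        (E₂ := fun y : M => TangentSpace 𝓘(ℝ, E) y) (E₃ := Bundle.Trivial M ℝ)
        (ϕ := s y) (v := v) (w := w) hy hy (Set.mem_univ _)
      refine this.trans ?_
      have hT : ∀ v : E, T y (e.symm y v) = v := fun v => by
        rw [← e.symmL_apply (R := ℝ) hy]
        exact e.continuousLinearMapAt_symmL (R := ℝ) hy v
      have h2 := hs y (e.symm y v) (e.symm y w)
      rw [hT, hT] at h2
      simpa using h2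
    · have h : B (T y v) (T y w) = B (T y w) (T y v) := by
        rw [hB, hB, real_inner_comm]
      exact h
    · rw [hs, hB]
      refine real_inner_self_pos.2 fun h0 => hv ?_
      have := e.symmL_continuousLinearMapAt (R := ℝ) hy v
      rw [← this]
      exact (congrArg (e.symmL ℝ y) h0).trans (map_zero _)

end RiemannianMetric

namespace Colombeau

open Set Filter

/-- The filter of parameters `ε` tending to `0`. -/
abbrev smallParam : Filter ParamInterval := comap (fun ε : ParamInterval => (ε : ℝ)) (𝓝 0)

theorem eventually_smallParam_iff {P : ParamInterval → Prop} :
    (∀ᶠ ε in smallParam, P ε) ↔ ∃ ε₀ : ℝ, 0 < ε₀ ∧ ∀ ε : ParamInterval, (ε : ℝ) < ε₀ → P ε := by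
  rw [(Metric.nhds_basis_ball.comap _).eventually_iff]
  refine exists_congr fun δ => and_congr_right fun _ => forall_congr' fun ε => ?_
  rw [mem_preimage, mem_ball_zero_iff, Real.norm_of_nonneg ε.2.1.le]

section Metric

variable {m : ℕ} {Y : Type*} [TopologicalSpace Y] [ChartedSpace (EuclideanSpace ℝ (Fin m)) Y]
  [IsManifold (𝓡 m) ∞ Y]
  (h : Bundle.ContMDiffRiemannianMetric (𝓡 m) ∞ (EuclideanSpace ℝ (Fin m))
      (fun y : Y => TangentSpace (𝓡 m) y))

/-- A Riemannian metric turns the manifold into a pseudo-emetric space with the same topology. -/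
theorem exists_pseudoEMetricSpace_metricDist [RegularSpace Y] :
    ∃ P : PseudoEMetricSpace Y, P.toUniformSpace.toTopologicalSpace = ‹TopologicalSpace Y› ∧
      ∀ y z, edist y z = metricDist h y z := by
  let _ : Bundle.RiemannianBundle (fun y : Y => TangentSpace (𝓡 m) y) := ⟨h.toRiemannianMetric⟩
  have : IsManifold (𝓡 m) 1 Y := IsManifold.of_le (n := ∞) (by simp)
  have : IsContinuousRiemannianBundle (EuclideanSpace ℝ (Fin m))
      (fun y : Y => TangentSpace (𝓡 m) y) := ⟨h.inner, h.contMDiff.continuous, fun _ _ _ => rfl⟩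
  exact ⟨PseudoEMetricSpace.ofRiemannianMetric (𝓡 m) Y, rfl, fun y z => rfl⟩

theorem metricDist_comm (y z : Y) : metricDist h y z = metricDist h z y :=
  let _ : Bundle.RiemannianBundle (fun y : Y => TangentSpace (𝓡 m) y) := ⟨h.toRiemannianMetric⟩
  Manifold.riemannianEDist_comm

theorem metricDist_self (y : Y) : metricDist h y y = 0 :=
  let _ : Bundle.RiemannianBundle (fun y : Y => TangentSpace (𝓡 m) y) := ⟨h.toRiemannianMetric⟩
  Manifold.riemannianEDist_self

theorem metricDist_triangle (x y z : Y) :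
    metricDist h x z ≤ metricDist h x y + metricDist h y z :=
  let _ : Bundle.RiemannianBundle (fun y : Y => TangentSpace (𝓡 m) y) := ⟨h.toRiemannianMetric⟩
  Manifold.riemannianEDist_triangle

theorem isOpen_setOf_metricDist_lt [RegularSpace Y] (y : Y) (r : ℝ≥0∞) :
    IsOpen {z | metricDist h y z < r} := by
  obtain ⟨P, rfl, hP⟩ := exists_pseudoEMetricSpace_metricDist h
  simp only [← hP, edist_comm y]
  exact Metric.isOpen_eball

theorem exists_metricDist_lt_imp_mem [RegularSpace Y] {A O : Set Y} (hA : IsCompact A)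
    (hO : IsOpen O) (hAO : A ⊆ O) : ∃ δ > 0, ∀ y ∈ A, ∀ z, metricDist h y z < δ → z ∈ O := by
  obtain ⟨P, rfl, hP⟩ := exists_pseudoEMetricSpace_metricDist h
  obtain ⟨δ, hδ, hδO⟩ := hA.exists_thickening_subset_open hO hAO
  refine ⟨ENNReal.ofReal δ, by simpa using hδ, fun y hy z hz => hδO ?_⟩
  rw [← hP, edist_comm] at hz
  exact Metric.mem_thickening_iff_exists_edist_lt _ _ |>.2 ⟨y, hy, hz⟩

end Metric

variable {n m : ℕ}
  {X : Type*} [TopologicalSpace X] [ChartedSpace (EuclideanSpace ℝ (Fin n)) X]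
  {Y : Type*} [TopologicalSpace Y] [ChartedSpace (EuclideanSpace ℝ (Fin m)) Y]
  {u v w : SmoothNet n m X Y}

/-- Local-to-global principle for c-bounded nets. -/
theorem IsCBounded.eventually_of_local (hu : IsCBounded u) {K : Set X} (hK : IsCompact K)
    {Q : ℕ → ParamInterval → X → Prop} (hQ : ∀ a b ε p, a ≤ b → Q a ε p → Q b ε p)
    (hloc : ∀ y : Y, ∃ A ∈ 𝓝 y, ∃ a, ∀ᶠ ε in smallParam, ∀ p ∈ K, u ε p ∈ A → Q a ε p) :
    ∃ a, ∀ᶠ ε in smallParam, ∀ p ∈ K, Q a ε p := by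
  obtain ⟨ε₀, hε₀, K', hK', hKK'⟩ := hu K hK
  have hev := eventually_smallParam_iff.2 ⟨ε₀, hε₀, hKK'⟩
  suffices h : ∃ a, ∀ᶠ ε in smallParam, ∀ p ∈ K, u ε p ∈ K' → Q a ε p by
    obtain ⟨a, ha⟩ := h
    refine ⟨a, ?_⟩
    filter_upwards [ha, hev] with ε h1 h2 p hp
    exact h1 p hp (h2 ⟨p, hp, rfl⟩)
  refine hK'.induction_on (p := fun A => ∃ a, ∀ᶠ ε in smallParam, ∀ p ∈ K, u ε p ∈ A → Q a ε p)
    ⟨0, by simp⟩ ?_ ?_ ?_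
  · rintro A B hAB ⟨a, ha⟩
    exact ⟨a, ha.mono fun ε h p hp hA => h p hp (hAB hA)⟩
  · rintro A B ⟨a, ha⟩ ⟨b, hb⟩
    refine ⟨max a b, ?_⟩
    filter_upwards [ha, hb] with ε h1 h2 p hp hAB
    rcases hAB with hA | hB
    · exact hQ _ _ _ _ (le_max_left _ _) (h1 p hp hA)
    · exact hQ _ _ _ _ (le_max_right _ _) (h2 p hp hB)
  · intro y _
    obtain ⟨A, hA, h⟩ := hloc y
    exact ⟨A, mem_nhdsWithin_of_mem_nhds hA, h⟩

/-- Topological form of uniform convergence on compact sets: whenever `A` is compact and contained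
in the open set `O`, points of a compact set sent to `A` by `u ε` are sent to `O` by `v ε`. -/
def CompactlyClose (u v : SmoothNet n m X Y) : Prop :=
  ∀ K : Set X, IsCompact K → ∀ A O : Set Y, IsCompact A → IsOpen O → A ⊆ O →
    ∀ᶠ ε in smallParam, ∀ p ∈ K, u ε p ∈ A → v ε p ∈ O

theorem CompactlyClose.trans [LocallyCompactSpace Y] [RegularSpace Y] (huv : CompactlyClose u v)
    (hvw : CompactlyClose v w) : CompactlyClose u w := by
  intro K hK A O hA hO hAO
  obtain ⟨B, hB, hAB, hBO⟩ := exists_compact_between hA hO hAO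
  filter_upwards [huv K hK A _ hA isOpen_interior hAB, hvw K hK B O hB hO hBO] with ε h1 h2 p hp hpA
  exact h2 p hp (interior_subset (h1 p hp hpA))

variable [IsManifold (𝓡 m) ∞ Y]
  {h : Bundle.ContMDiffRiemannianMetric (𝓡 m) ∞ (EuclideanSpace ℝ (Fin m))
      (fun y : Y => TangentSpace (𝓡 m) y)}

theorem CompactlyClose.of_tendsto [RegularSpace Y]
    (huv : ∀ K : Set X, IsCompact K →
      Tendsto (fun ε : ParamInterval => ⨆ p ∈ K, metricDist h (u ε p) (v ε p)) smallParam (𝓝 0)) :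
    CompactlyClose u v := by
  intro K hK A O hA hO hAO
  obtain ⟨δ, hδ, hδO⟩ := exists_metricDist_lt_imp_mem h hA hO hAO
  filter_upwards [(huv K hK).eventually (gt_mem_nhds hδ)] with ε hε p hp hpA
  exact hδO _ hpA _ ((le_iSup₂ (f := fun p _ => metricDist h (u ε p) (v ε p)) p hp).trans_lt hε)

theorem CompactlyClose.tendsto [T2Space Y] (huv : CompactlyClose u v) (hu : IsCBounded u)
    {K : Set X} (hK : IsCompact K) :
    Tendsto (fun ε : ParamInterval => ⨆ p ∈ K, metricDist h (u ε p) (v ε p))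
      smallParam (𝓝 0) := by
  have : LocallyCompactSpace Y := ChartedSpace.locallyCompactSpace (EuclideanSpace ℝ (Fin m)) Y
  rw [ENNReal.tendsto_nhds_zero]
  intro δ hδ
  obtain ⟨-, ha⟩ := hu.eventually_of_local hK (u := u)
    (Q := fun _ ε p => metricDist h (u ε p) (v ε p) ≤ δ) (fun _ _ _ _ _ h => h) fun y => by
      have hO := isOpen_setOf_metricDist_lt h y (δ / 2)
      have hy : y ∈ {z | metricDist h y z < δ / 2} := by
        simpa [metricDist_self] using hδ.ne'
      obtain ⟨A, hA, hyA, hAO⟩ := exists_compact_subset hO hy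
      refine ⟨A, mem_interior_iff_mem_nhds.1 hyA, 0, ?_⟩
      filter_upwards [huv K hK A _ hA hO hAO] with ε hε p hp hpA
      calc _ ≤ metricDist h (u ε p) y + metricDist h y (v ε p) := metricDist_triangle h _ _ _
        _ ≤ δ / 2 + δ / 2 := by
          refine add_le_add ?_ (hε p hp hpA).le
          rw [metricDist_comm]
          exact (hAO hpA).le
        _ = δ := ENNReal.add_halves δ
  filter_upwards [ha] with ε hε
  exact iSup₂_le hε

theorem IsEquivalent.compactlyClose [RegularSpace Y] (huv : IsEquivalent u v) :
    CompactlyClose u v :=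
  let ⟨_, hh⟩ := huv.1
  .of_tendsto hh

theorem CompactlyClose.exists_tendsto [T2Space Y] [ParacompactSpace Y] (huv : CompactlyClose u v)
    (hu : IsCBounded u) :
    ∃ h : Bundle.ContMDiffRiemannianMetric (𝓡 m) ∞ (EuclideanSpace ℝ (Fin m))
      (fun y : Y => TangentSpace (𝓡 m) y),
    ∀ K : Set X, IsCompact K →
      Tendsto (fun ε : ParamInterval => ⨆ p ∈ K, metricDist h (u ε p) (v ε p))
        (comap (fun ε : ParamInterval => (ε : ℝ)) (𝓝 0)) (𝓝 0) := by
  obtain ⟨h⟩ := nonempty_contMDiffRiemannianMetric (E := EuclideanSpace ℝ (Fin m)) Y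
  exact ⟨h, fun K hK => huv.tendsto hu hK⟩

end Colombeau

section Calculus

open Set Filter

universe uE uF
variable {D : Type*} {E : Type uE} {F : Type uF} {G : Type*}
  [NormedAddCommGroup D] [NormedSpace ℝ D]
  [NormedAddCommGroup E] [NormedSpace ℝ E] [NormedAddCommGroup F] [NormedSpace ℝ F]
  [NormedAddCommGroup G] [NormedSpace ℝ G]

/-- Pointwise version of `ContinuousLinearMap.norm_iteratedFDeriv_le_of_bilinear`. -/
theorem ContinuousLinearMap.norm_iteratedFDeriv_le_of_bilinear_of_contDiffAt
    (B : E →L[ℝ] F →L[ℝ] G) {f : D → E} {g : D → F} {x : D} {k : ℕ}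
    (hf : ContDiffAt ℝ k f x) (hg : ContDiffAt ℝ k g x) (hB : ‖B‖ ≤ 1) :
    ‖iteratedFDeriv ℝ k (fun y => B (f y) (g y)) x‖ ≤ ∑ i ∈ Finset.range (k + 1),
      (k.choose i : ℝ) * ‖iteratedFDeriv ℝ i f x‖ * ‖iteratedFDeriv ℝ (k - i) g x‖ := by
  obtain ⟨s, hs, hfs⟩ := hf.contDiffOn (m := k) le_rfl (by simp)
  obtain ⟨t, ht, hgt⟩ := hg.contDiffOn (m := k) le_rfl (by simp)
  obtain ⟨r, hr, hro, hxr⟩ := mem_nhds_iff.1 (inter_mem hs ht)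
  have h := B.norm_iteratedFDerivWithin_le_of_bilinear_of_le_one
    (hfs.mono (hr.trans inter_subset_left)) (hgt.mono (hr.trans inter_subset_right))
    hro.uniqueDiffOn hxr le_rfl hB
  simpa only [iteratedFDerivWithin_of_isOpen _ hro hxr] using h

/-- Pointwise version of `norm_iteratedFDeriv_comp_le`. -/
theorem norm_iteratedFDeriv_comp_le_of_contDiffAt {g : F → G} {f : E → F} {x : E} {k : ℕ}
    (hg : ContDiffAt ℝ k g (f x)) (hf : ContDiffAt ℝ k f x) {C M : ℝ}
    (hC : ∀ i ≤ k, ‖iteratedFDeriv ℝ i g (f x)‖ ≤ C)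
    (hM : ∀ i, 1 ≤ i → i ≤ k → ‖iteratedFDeriv ℝ i f x‖ ≤ M ^ i) :
    ‖iteratedFDeriv ℝ k (fun y => g (f y)) x‖ ≤ k.factorial * C * M ^ k := by
  obtain ⟨s, hs, hfs⟩ := hf.contDiffOn (m := k) le_rfl (by simp)
  obtain ⟨t, ht, hgt⟩ := hg.contDiffOn (m := k) le_rfl (by simp)
  obtain ⟨t', ht', hto, hxt⟩ := mem_nhds_iff.1 ht
  obtain ⟨r, hr, hro, hxr⟩ := mem_nhds_iff.1
    (inter_mem hs (hf.continuousAt.preimage_mem_nhds (hto.mem_nhds hxt)))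
  have h := norm_iteratedFDerivWithin_comp_le (hgt.mono ht')
    (hfs.mono (hr.trans inter_subset_left)) le_rfl hto.uniqueDiffOn hro.uniqueDiffOn
    (fun y hy => (hr hy).2) hxr (C := C) (D := M)
    (fun i hi => by rw [iteratedFDerivWithin_of_isOpen _ hto hxt]; exact hC i hi)
    (fun i h1 hi => by rw [iteratedFDerivWithin_of_isOpen _ hro hxr]; exact hM i h1 hi)
  rwa [iteratedFDerivWithin_of_isOpen _ hro hxr] at h

theorem norm_iteratedFDeriv_comp_le_of_bound {g : F → G} {f : E → F} {x : E} {k : ℕ}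
    (hg : ContDiffAt ℝ k g (f x)) (hf : ContDiffAt ℝ k f x) {C M : ℝ} (hM1 : 1 ≤ M)
    (hC : ∀ i ≤ k, ‖iteratedFDeriv ℝ i g (f x)‖ ≤ C)
    (hM : ∀ i, 1 ≤ i → i ≤ k → ‖iteratedFDeriv ℝ i f x‖ ≤ M) :
    ‖iteratedFDeriv ℝ k (fun y => g (f y)) x‖ ≤ k.factorial * C * M ^ k :=
  norm_iteratedFDeriv_comp_le_of_contDiffAt hg hf hC fun i h1 hi =>
    (hM i h1 hi).trans (le_self_pow₀ hM1 (by omega))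

set_option synthInstance.maxHeartbeats 400000 in
set_option maxHeartbeats 1000000 in
/-- Leibniz bound for the pointwise composition of continuous linear maps. -/
theorem norm_iteratedFDeriv_clm_comp_le {P : D → F →L[ℝ] G} {Q : D → E →L[ℝ] F} {x : D} {k : ℕ}
    (hP : ContDiffAt ℝ k P x) (hQ : ContDiffAt ℝ k Q x) :
    ‖iteratedFDeriv ℝ k (fun y => (P y).comp (Q y)) x‖ ≤ ∑ i ∈ Finset.range (k + 1),
      (k.choose i : ℝ) * ‖iteratedFDeriv ℝ i P x‖ * ‖iteratedFDeriv ℝ (k - i) Q x‖ :=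
  (ContinuousLinearMap.compL ℝ E F G).norm_iteratedFDeriv_le_of_bilinear_of_contDiffAt hP hQ
    (ContinuousLinearMap.norm_compL_le ℝ E F G)

set_option synthInstance.maxHeartbeats 200000 in
/-- Quantitative continuity of composition in the inner function, at a point: the derivatives of
`g ∘ f - g ∘ f'` are controlled by those of `f - f'`. -/
theorem exists_norm_iteratedFDeriv_comp_sub_comp_le
    (E : Type uE) [NormedAddCommGroup E] [NormedSpace ℝ E]
    (F : Type uF) [NormedAddCommGroup F] [NormedSpace ℝ F] (k : ℕ) :
    ∃ C : ℝ, 0 ≤ C ∧ ∀ (G : Type uF) [NormedAddCommGroup G] [NormedSpace ℝ G] (g : F → G)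
      (f f' : E → F) (x : E) (M δ : ℝ), 1 ≤ M → 0 ≤ δ →
      (∀ y ∈ segment ℝ (f x) (f' x), ContDiffAt ℝ ∞ g y) →
      ContDiffAt ℝ ∞ f x → ContDiffAt ℝ ∞ f' x →
      (∀ j, 1 ≤ j → j ≤ k + 1 → ∀ y ∈ segment ℝ (f x) (f' x), ‖iteratedFDeriv ℝ j g y‖ ≤ M) →
      (∀ i, 1 ≤ i → i ≤ k → ‖iteratedFDeriv ℝ i f x‖ ≤ M) →
      (∀ i, 1 ≤ i → i ≤ k → ‖iteratedFDeriv ℝ i f' x‖ ≤ M) →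
      (∀ i ≤ k, ‖iteratedFDeriv ℝ i (fun y => f y - f' y) x‖ ≤ δ) →
      ∀ i ≤ k, ‖iteratedFDeriv ℝ i (fun y => g (f y) - g (f' y)) x‖ ≤ C * M ^ (k + 1) * δ := by
  induction k with
  | zero =>
    refine ⟨1, zero_le_one, ?_⟩
    intro G _ _ g f f' x M δ hM hδ hg hf hf' hgM _ _ hff' i hi
    obtain rfl : i = 0 := by omega
    rw [norm_iteratedFDeriv_zero]
    have h0 := hff' 0 le_rfl
    rw [norm_iteratedFDeriv_zero] at h0
    have := (convex_segment (f x) (f' x)).norm_image_sub_le_of_norm_fderiv_le (𝕜 := ℝ) (f := g)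
      (C := M) (fun y hy => (hg y hy).differentiableAt (by simp))
      (fun y hy => by
        have := hgM 1 le_rfl le_rfl y hy
        rwa [norm_iteratedFDeriv_one] at this)
      (right_mem_segment ℝ _ _) (left_mem_segment ℝ _ _)
    refine this.trans ?_
    rw [one_mul, zero_add, pow_one]
    gcongr
  | succ k ih =>
    obtain ⟨C, hC0, hC⟩ := ih
    set C₁ : ℝ := ∑ i ∈ Finset.range (k + 1), (k.choose i : ℝ) * (C + i.factorial) with hC₁
    have hC₁0 : 0 ≤ C₁ := Finset.sum_nonneg fun i _ => by positivity
    refine ⟨C + C₁, by positivity, ?_⟩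
    intro G _ _ g f f' x M δ hM hδ hg hf hf' hgM hfM hf'M hff' i hi
    rcases Nat.lt_or_ge i (k + 1) with hik | hik
    · refine (hC G g f f' x M δ hM hδ hg hf hf' (fun j h1 hj => hgM j h1 (by omega))
        (fun j h1 hj => hfM j h1 (by omega)) (fun j h1 hj => hf'M j h1 (by omega))
        (fun j hj => hff' j (by omega)) i (by omega)).trans ?_
      gcongr
      · linarith
      · omega
    obtain rfl : i = k + 1 := by omega
    have hM0 : 0 ≤ M := zero_le_one.trans hM
    have hgf := hg _ (left_mem_segment ℝ _ _)
    have hgf' := hg _ (right_mem_segment ℝ _ _)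
    have hDg : ∀ y ∈ segment ℝ (f x) (f' x), ContDiffAt ℝ ∞ (fderiv ℝ g) y := fun y hy =>
      (hg y hy).fderiv_right (m := ∞) (by simp)
    have hDf : ContDiffAt ℝ ∞ (fderiv ℝ f) x := hf.fderiv_right (m := ∞) (by simp)
    have hDf' : ContDiffAt ℝ ∞ (fderiv ℝ f') x := hf'.fderiv_right (m := ∞) (by simp)
    have hDgf : ContDiffAt ℝ ∞ (fun y => fderiv ℝ g (f y)) x :=
      (hDg _ (left_mem_segment ℝ _ _)).comp x hf
    have hDgf' : ContDiffAt ℝ ∞ (fun y => fderiv ℝ g (f' y)) x :=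
      (hDg _ (right_mem_segment ℝ _ _)).comp x hf'
    have hev {φ : E → F} (hφ : ContDiffAt ℝ ∞ φ x) (hgφ : ContDiffAt ℝ ∞ g (φ x)) :
        ∀ᶠ y in 𝓝 x, DifferentiableAt ℝ φ y ∧ DifferentiableAt ℝ g (φ y) := by
      have h1 := (hφ.of_le (m := 1) (by simp)).eventually (by simp)
      have h2 := hφ.continuousAt.eventually ((hgφ.of_le (m := 1) (by simp)).eventually (by simp))
      filter_upwards [h1, h2] with y h1 h2
      exact ⟨h1.differentiableAt (by simp), h2.differentiableAt (by simp)⟩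
    have hfd : fderiv ℝ (fun y => g (f y) - g (f' y)) =ᶠ[𝓝 x] fun y =>
        (fderiv ℝ g (f y) - fderiv ℝ g (f' y)).comp (fderiv ℝ f y) +
          (fderiv ℝ g (f' y)).comp (fderiv ℝ f y - fderiv ℝ f' y) := by
      filter_upwards [hev hf hgf, hev hf' hgf'] with y ⟨h1, h2⟩ ⟨h3, h4⟩
      have e1 : fderiv ℝ (fun y => g (f y)) y = (fderiv ℝ g (f y)).comp (fderiv ℝ f y) :=
        fderiv_comp y h2 h1
      have e2 : fderiv ℝ (fun y => g (f' y)) y = (fderiv ℝ g (f' y)).comp (fderiv ℝ f' y) :=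
        fderiv_comp y h4 h3
      have e3 : fderiv ℝ (fun y => g (f y) - g (f' y)) y =
          fderiv ℝ (fun y => g (f y)) y - fderiv ℝ (fun y => g (f' y)) y :=
        fderiv_sub (h2.comp y h1) (h4.comp y h3)
      rw [e3, e1, e2]
      rw [ContinuousLinearMap.sub_comp, ContinuousLinearMap.comp_sub]
      abel
    have hsub : (fun y => fderiv ℝ f y - fderiv ℝ f' y) =ᶠ[𝓝 x]
        fderiv ℝ (fun y => f y - f' y) := by
      filter_upwards [hev hf hgf, hev hf' hgf'] with y ⟨h1, _⟩ ⟨h3, _⟩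
      rw [fderiv_fun_sub h1 h3]
    have hle : ((k : ℕ) : WithTop ℕ∞) ≤ (∞ : WithTop ℕ∞) := by exact_mod_cast le_top
    have hP := fun i (hi : i ≤ k) => hC (F →L[ℝ] G) (fderiv ℝ g) f f' x M δ hM hδ hDg hf hf'
      (fun j h1 hj y hy => by
        rw [norm_iteratedFDeriv_fderiv]
        exact hgM (j + 1) (by omega) (by omega) y hy)
      (fun j h1 hj => hfM j h1 (by omega)) (fun j h1 hj => hf'M j h1 (by omega))
      (fun j hj => hff' j (by omega)) i hi
    have hR : ∀ i ≤ k, ‖iteratedFDeriv ℝ i (fun y => fderiv ℝ g (f' y)) x‖ ≤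
        i.factorial * M * M ^ i := fun i hi => by
      have hle' : ((i : ℕ) : WithTop ℕ∞) ≤ (∞ : WithTop ℕ∞) := by exact_mod_cast le_top
      refine norm_iteratedFDeriv_comp_le_of_bound
        ((hDg _ (right_mem_segment ℝ _ _)).of_le hle') (hf'.of_le hle') hM (fun j hj => ?_)
        fun j h1 hj => hf'M j h1 (by omega)
      rw [norm_iteratedFDeriv_fderiv]
      exact hgM (j + 1) (by omega) (by omega) _ (right_mem_segment ℝ _ _)
    have h1 := norm_iteratedFDeriv_clm_comp_le
      ((hDgf.sub hDgf').of_le hle) (hDf.of_le hle)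
    have h2 := norm_iteratedFDeriv_clm_comp_le
      (hDgf'.of_le hle) ((hDf.sub hDf').of_le hle)
    have hc1 : ContDiffAt ℝ k (fun y => (fderiv ℝ g (f y) - fderiv ℝ g (f' y)).comp (fderiv ℝ f y))
        x := ((hDgf.sub hDgf').clm_comp hDf).of_le hle
    have hc2 : ContDiffAt ℝ k (fun y => (fderiv ℝ g (f' y)).comp (fderiv ℝ f y - fderiv ℝ f' y))
        x := (hDgf'.clm_comp (hDf.sub hDf')).of_le hle
    rw [← norm_iteratedFDeriv_fderiv, (hfd.iteratedFDeriv ℝ k).eq_of_nhds,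
      fun_iteratedFDeriv_add_apply hc1 hc2]
    refine (norm_add_le _ _).trans ((add_le_add h1 h2).trans ?_)
    rw [← Finset.sum_add_distrib]
    calc _ ≤ ∑ i ∈ Finset.range (k + 1),
          (k.choose i : ℝ) * (C + i.factorial) * (M ^ (k + 1 + 1) * δ) := by
          refine Finset.sum_le_sum fun i hi => ?_
          have hi : i ≤ k := by simpa [Nat.lt_succ_iff] using hi
          have hq : ‖iteratedFDeriv ℝ (k - i) (fderiv ℝ f) x‖ ≤ M := by
            rw [norm_iteratedFDeriv_fderiv]
            exact hfM _ (by omega) (by omega)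
          have hs : ‖iteratedFDeriv ℝ (k - i) (fun y => fderiv ℝ f y - fderiv ℝ f' y) x‖ ≤ δ := by
            rw [(hsub.iteratedFDeriv ℝ _).eq_of_nhds, norm_iteratedFDeriv_fderiv]
            exact hff' _ (by omega)
          have hMi : M ^ (i + 1) ≤ M ^ (k + 1 + 1) := pow_le_pow_right₀ hM (by omega)
          calc _ ≤ (k.choose i : ℝ) * (C * M ^ (k + 1) * δ) * M +
                (k.choose i : ℝ) * (i.factorial * M * M ^ i) * δ := by
                gcongr
                · exact hP i hi
                · exact hR i hi
            _ = (k.choose i : ℝ) * (C * (M ^ (k + 1 + 1) * δ) +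
                i.factorial * (M ^ (i + 1) * δ)) := by ring
            _ ≤ (k.choose i : ℝ) * (C * (M ^ (k + 1 + 1) * δ) +
                i.factorial * (M ^ (k + 1 + 1) * δ)) := by gcongr
            _ = _ := by ring
      _ = C₁ * (M ^ (k + 1 + 1) * δ) := by rw [← Finset.sum_mul]
      _ ≤ (C + C₁) * (M ^ (k + 1 + 1) * δ) := by
          gcongr
          linarith
      _ = _ := by ring

end Calculus

namespace Colombeau

open Set Filter

section Growth

/-- The standard polynomial growth rates `(a + 1) ε⁻ᵃ`. -/
noncomputable def growth (a : ℕ) (ε : ParamInterval) : ℝ := (a + 1) * ((ε : ℝ) ^ a)⁻¹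

theorem growth_mono {a b : ℕ} (hab : a ≤ b) (ε : ParamInterval) : growth a ε ≤ growth b ε := by
  have h0 := ε.2.1
  have h1 := ε.2.2
  have h2 : (ε : ℝ) ^ b ≤ (ε : ℝ) ^ a := pow_le_pow_of_le_one h0.le h1 hab
  have h3 : (a : ℝ) ≤ b := by exact_mod_cast hab
  unfold growth
  gcongr

theorem natCast_add_one_le_growth (a : ℕ) (ε : ParamInterval) : (a : ℝ) + 1 ≤ growth a ε := by
  have h : (1 : ℝ) ≤ ((ε : ℝ) ^ a)⁻¹ :=
    (one_le_inv₀ (pow_pos ε.2.1 a)).2 (pow_le_one₀ ε.2.1.le ε.2.2)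
  exact le_mul_of_one_le_right (by positivity) h

theorem one_le_growth (a : ℕ) (ε : ParamInterval) : 1 ≤ growth a ε :=
  le_trans (by linarith [(a.cast_nonneg : (0 : ℝ) ≤ a)]) (natCast_add_one_le_growth a ε)

theorem growth_pow_mul_pow (a k q : ℕ) (ε : ParamInterval) :
    growth a ε ^ k * (ε : ℝ) ^ (q + a * k) = (a + 1) ^ k * (ε : ℝ) ^ q := by
  have h0 : (ε : ℝ) ≠ 0 := ε.2.1.ne'
  rw [growth, mul_pow, inv_pow, ← pow_mul, pow_add]
  field_simp

theorem exists_growth_ge (N a b k : ℕ) :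
    ∃ c, ∀ ε, N * growth b ε * growth a ε ^ k ≤ growth c ε := by
  refine ⟨N * (b + 1) * (a + 1) ^ k + (b + a * k), fun ε => ?_⟩
  have h0 := ε.2.1
  have h2 : (ε : ℝ) ^ (N * (b + 1) * (a + 1) ^ k + (b + a * k)) ≤ (ε : ℝ) ^ (b + a * k) :=
    pow_le_pow_of_le_one h0.le ε.2.2 (by omega)
  calc N * growth b ε * growth a ε ^ k
      = (N * (b + 1) * (a + 1) ^ k) * ((ε : ℝ) ^ (b + a * k))⁻¹ := by
        rw [growth, growth, mul_pow, inv_pow, ← pow_mul, pow_add, mul_inv]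
        ring
    _ ≤ _ := by
        unfold growth
        push_cast
        gcongr
        have : (0 : ℝ) ≤ (b + a * k : ℝ) := by positivity
        linarith

/-- Finitely many eventual bounds with monotone constants can be taken uniform. -/
theorem exists_eventually_forall_le {Q : ℕ → ℕ → ParamInterval → Prop}
    (hQ : ∀ i a b ε, a ≤ b → Q i a ε → Q i b ε) (k : ℕ)
    (h : ∀ i ≤ k, ∃ a, ∀ᶠ ε in smallParam, Q i a ε) :
    ∃ a, ∀ᶠ ε in smallParam, ∀ i ≤ k, Q i a ε := by
  induction k with
  | zero =>
    obtain ⟨a, ha⟩ := h 0 le_rfl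
    refine ⟨a, ha.mono fun ε hε i hi => ?_⟩
    obtain rfl : i = 0 := by omega
    exact hε
  | succ k ih =>
    obtain ⟨a, ha⟩ := ih fun i hi => h i (by omega)
    obtain ⟨b, hb⟩ := h (k + 1) le_rfl
    refine ⟨max a b, ?_⟩
    filter_upwards [ha, hb] with ε h1 h2 i hi
    rcases Nat.lt_or_ge i (k + 1) with hik | hik
    · exact hQ _ _ _ _ (le_max_left _ _) (h1 i (by omega))
    · obtain rfl : i = k + 1 := by omega
      exact hQ _ _ _ _ (le_max_right _ _) h2

theorem eventually_mul_lt (C : ℝ) {δ : ℝ} (hδ : 0 < δ) :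
    ∀ᶠ ε : ParamInterval in smallParam, C * (ε : ℝ) < δ := by
  have h : Tendsto (fun ε : ParamInterval => C * (ε : ℝ)) smallParam (𝓝 (C * 0)) :=
    tendsto_comap.const_mul C
  rw [mul_zero] at h
  exact h.eventually (gt_mem_nhds hδ)

end Growth

section Charts

variable {n m l : ℕ}
  {X : Type*} [TopologicalSpace X] [ChartedSpace (EuclideanSpace ℝ (Fin n)) X]
  {Y : Type*} [TopologicalSpace Y] [ChartedSpace (EuclideanSpace ℝ (Fin m)) Y]
  {φ : OpenPartialHomeomorph X (EuclideanSpace ℝ (Fin n))}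
  {ψ : OpenPartialHomeomorph Y (EuclideanSpace ℝ (Fin m))}

theorem contDiffAt_chart_expression [IsManifold (𝓡 n) ∞ X] [IsManifold (𝓡 m) ∞ Y]
    (hφ : φ ∈ SmoothCharts n X) (hψ : ψ ∈ SmoothCharts m Y)
    (f : ContMDiffMap (𝓡 n) (𝓡 m) X Y ∞) {p : X} (hp : p ∈ φ.source) (hfp : f p ∈ ψ.source) :
    ContDiffAt ℝ ∞ (fun x => ψ (f (φ.symm x))) (φ p) := by
  rw [← contMDiffAt_iff_contDiffAt]
  have h1 : ContMDiffAt (𝓡 n) (𝓡 n) ∞ φ.symm (φ p) :=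
    (contMDiffOn_symm_of_mem_maximalAtlas hφ).contMDiffAt
      (φ.open_target.mem_nhds (φ.map_source hp))
  have h3 : ContMDiffAt (𝓡 m) (𝓡 m) ∞ ψ (f (φ.symm (φ p))) := by
    rw [φ.left_inv hp]
    exact (contMDiffOn_of_mem_maximalAtlas hψ).contMDiffAt (ψ.open_source.mem_nhds hfp)
  exact (h3.comp (φ p) (f.contMDiff.contMDiffAt.comp (φ p) h1))

theorem eventually_apply_symm_mem_source (f : ContMDiffMap (𝓡 n) (𝓡 m) X Y ∞) {p : X}
    (hp : p ∈ φ.source) (hfp : f p ∈ ψ.source) :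
    ∀ᶠ x in 𝓝 (φ p), f (φ.symm x) ∈ ψ.source := by
  have h : ContinuousAt (fun x => f (φ.symm x)) (φ p) :=
    ContinuousAt.comp (g := f) f.contMDiff.continuous.continuousAt
      (φ.symm.continuousAt (φ.map_source hp))
  refine h.preimage_mem_nhds (ψ.open_source.mem_nhds ?_)
  rwa [φ.left_inv hp]

/-- Around each point there is a chart and a basis-like triple of neighbourhoods `A ⊆ O ⊆ B`, with
`B` compact and convex in the chart. -/
theorem exists_convex_chart_neighborhoods [IsManifold (𝓡 m) ∞ Y] (y : Y) :
    ∃ ψ ∈ SmoothCharts m Y, ∃ A O B : Set Y, A ∈ 𝓝 y ∧ IsCompact A ∧ IsOpen O ∧ A ⊆ O ∧ O ⊆ B ∧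
      IsCompact B ∧ B ⊆ ψ.source ∧ Convex ℝ (ψ '' B) := by
  set ψ := chartAt (EuclideanSpace ℝ (Fin m)) y with hψ
  have hy : y ∈ ψ.source := mem_chart_source _ y
  obtain ⟨R, hR, hRt⟩ := Metric.nhds_basis_closedBall.mem_iff.1
    (ψ.open_target.mem_nhds (ψ.map_source hy))
  have hsub : Metric.closedBall (ψ y) (R / 2) ⊆ Metric.ball (ψ y) R :=
    Metric.closedBall_subset_ball (by linarith)
  have hcpt : ∀ r ≤ R, IsCompact (ψ.symm '' Metric.closedBall (ψ y) r) := fun r hr =>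
    (isCompact_closedBall _ _).image_of_continuousOn
      (ψ.continuousOn_symm.mono ((Metric.closedBall_subset_closedBall hr).trans hRt))
  refine ⟨ψ, IsManifold.chart_mem_maximalAtlas y, ψ.symm '' Metric.closedBall (ψ y) (R / 2),
    ψ.source ∩ ψ ⁻¹' Metric.ball (ψ y) R, ψ.symm '' Metric.closedBall (ψ y) R, ?_,
    hcpt _ (by linarith), ψ.isOpen_inter_preimage Metric.isOpen_ball, ?_, ?_, hcpt _ le_rfl, ?_, ?_⟩
  · filter_upwards [ψ.open_source.mem_nhds hy, (ψ.continuousAt hy).preimage_mem_nhds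
      (Metric.closedBall_mem_nhds (ψ y) (half_pos hR))] with z hz hz'
    exact ⟨ψ z, hz', ψ.left_inv hz⟩
  · rintro _ ⟨x, hx, rfl⟩
    have hxt : x ∈ ψ.target := hRt (Metric.ball_subset_closedBall (hsub hx))
    refine ⟨ψ.map_target hxt, ?_⟩
    rw [mem_preimage, ψ.right_inv hxt]
    exact hsub hx
  · rintro z ⟨hz, hz'⟩
    exact ⟨ψ z, Metric.ball_subset_closedBall hz', ψ.left_inv hz⟩
  · rintro _ ⟨x, hx, rfl⟩
    exact ψ.map_target (hRt hx)
  · have : ψ '' (ψ.symm '' Metric.closedBall (ψ y) R) = Metric.closedBall (ψ y) R := by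
      rw [image_image]
      refine (image_congr fun x hx => ψ.right_inv (hRt hx)).trans ?_
      simp
    rw [this]
    exact convex_closedBall _ _

end Charts

section NormalForms

variable {n m : ℕ}
  {X : Type*} [TopologicalSpace X] [ChartedSpace (EuclideanSpace ℝ (Fin n)) X]
  {Y : Type*} [TopologicalSpace Y] [ChartedSpace (EuclideanSpace ℝ (Fin m)) Y]
  {φ : OpenPartialHomeomorph X (EuclideanSpace ℝ (Fin n))}
  {ψ : OpenPartialHomeomorph Y (EuclideanSpace ℝ (Fin m))}
  {u v w : SmoothNet n m X Y} {L : Set X} {L' : Set Y}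

theorem IsModerate.exists_growth (hu : IsModerate u) (k : ℕ) (hφ : φ ∈ SmoothCharts n X)
    (hψ : ψ ∈ SmoothCharts m Y) (hL : IsCompact L) (hLφ : L ⊆ φ.source) (hL' : IsCompact L')
    (hLψ : L' ⊆ ψ.source) :
    ∃ a, ∀ᶠ ε in smallParam, ∀ i ≤ k, 1 ≤ i → ∀ p ∈ L, u ε p ∈ L' →
      ‖iteratedFDeriv ℝ i (fun x => ψ (u ε (φ.symm x))) (φ p)‖ ≤ growth a ε := by
  refine exists_eventually_forall_le
    (fun i a b ε hab h h1 p hp hpL => (h h1 p hp hpL).trans (growth_mono hab ε)) k fun i _ => ?_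
  rcases Nat.eq_zero_or_pos i with rfl | hi
  · exact ⟨0, by simp⟩
  obtain ⟨N, ε₁, hε₁, C, hC, h⟩ := hu.2 i hi φ hφ ψ hψ L hL hLφ L' hL' hLψ
  refine ⟨max N ⌈C⌉₊, eventually_smallParam_iff.2 ⟨ε₁, hε₁, fun ε hε _ p hp hpL =>
    (h ε hε p hp hpL).trans ?_⟩⟩
  have h0 := ε.2.1
  have h2 : (ε : ℝ) ^ max N ⌈C⌉₊ ≤ (ε : ℝ) ^ N :=
    pow_le_pow_of_le_one h0.le ε.2.2 (le_max_left _ _)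
  have h3 : C ≤ (max N ⌈C⌉₊ : ℕ) :=
    (Nat.le_ceil C).trans (by exact_mod_cast le_max_right _ _)
  unfold growth
  gcongr
  linarith

theorem isModerate_of_exists_growth (hu : IsCBounded u)
    (h : ∀ k : ℕ, 1 ≤ k → ∀ φ ∈ SmoothCharts n X, ∀ ψ ∈ SmoothCharts m Y,
      ∀ L : Set X, IsCompact L → L ⊆ φ.source → ∀ L' : Set Y, IsCompact L' → L' ⊆ ψ.source →
      ∃ a, ∀ᶠ ε in smallParam, ∀ p ∈ L, u ε p ∈ L' →
        ‖iteratedFDeriv ℝ k (fun x => ψ (u ε (φ.symm x))) (φ p)‖ ≤ growth a ε) :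
    IsModerate u := by
  refine ⟨hu, fun k hk φ hφ ψ hψ L hL hLφ L' hL' hLψ => ?_⟩
  obtain ⟨a, ha⟩ := h k hk φ hφ ψ hψ L hL hLφ L' hL' hLψ
  obtain ⟨ε₁, hε₁, h⟩ := eventually_smallParam_iff.1 ha
  exact ⟨a, ε₁, hε₁, a + 1, by positivity, h⟩

theorem IsEquivalent.exists_bound [IsManifold (𝓡 m) ∞ Y] (huv : IsEquivalent u v) (k q : ℕ)
    (hφ : φ ∈ SmoothCharts n X)
    (hψ : ψ ∈ SmoothCharts m Y) (hL : IsCompact L) (hLφ : L ⊆ φ.source) (hL' : IsCompact L')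
    (hLψ : L' ⊆ ψ.source) :
    ∃ a : ℕ, ∀ᶠ ε in smallParam, ∀ i ≤ k, ∀ p ∈ L, u ε p ∈ L' → v ε p ∈ L' →
      ‖iteratedFDeriv ℝ i (fun x => ψ (u ε (φ.symm x)) - ψ (v ε (φ.symm x))) (φ p)‖ ≤
        a * (ε : ℝ) ^ q := by
  refine exists_eventually_forall_le (fun i a b ε hab h p hp hpL hpL' =>
    (h p hp hpL hpL').trans (mul_le_mul_of_nonneg_right (by exact_mod_cast hab)
      (pow_nonneg ε.2.1.le q))) k fun i _ => ?_
  obtain ⟨ε₁, hε₁, C, hC, h⟩ := huv.2 i q φ hφ ψ hψ L hL hLφ L' hL' hLψ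
  refine ⟨⌈C⌉₊, eventually_smallParam_iff.2 ⟨ε₁, hε₁, fun ε hε p hp hpL hpL' =>
    (h ε hε p hp hpL hpL').trans ?_⟩⟩
  have := pow_nonneg ε.2.1.le q
  gcongr
  exact Nat.le_ceil C

theorem isEquivalent_of_exists_bound [IsManifold (𝓡 m) ∞ Y] [T2Space Y] [ParacompactSpace Y]
    (hu : IsCBounded u) (huv : CompactlyClose u v)
    (h : ∀ k q : ℕ, ∀ φ ∈ SmoothCharts n X, ∀ ψ ∈ SmoothCharts m Y,
      ∀ L : Set X, IsCompact L → L ⊆ φ.source → ∀ L' : Set Y, IsCompact L' → L' ⊆ ψ.source →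
      ∃ a : ℕ, ∀ᶠ ε in smallParam, ∀ p ∈ L, u ε p ∈ L' → v ε p ∈ L' →
        ‖iteratedFDeriv ℝ k (fun x => ψ (u ε (φ.symm x)) - ψ (v ε (φ.symm x))) (φ p)‖ ≤
          a * (ε : ℝ) ^ q) :
    IsEquivalent u v := by
  refine ⟨huv.exists_tendsto hu, fun k q φ hφ ψ hψ L hL hLφ L' hL' hLψ => ?_⟩
  obtain ⟨a, ha⟩ := h k q φ hφ ψ hψ L hL hLφ L' hL' hLψ
  obtain ⟨ε₁, hε₁, h⟩ := eventually_smallParam_iff.1 ha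
  refine ⟨ε₁, hε₁, a + 1, by positivity, fun ε hε p hp hpL hpL' =>
    (h ε hε p hp hpL hpL').trans ?_⟩
  have := pow_nonneg ε.2.1.le q
  gcongr
  linarith

theorem IsEquivalent.symm [IsManifold (𝓡 m) ∞ Y] (huv : IsEquivalent u v) : IsEquivalent v u := by
  obtain ⟨⟨h, hh⟩, h2⟩ := huv
  refine ⟨⟨h, fun K hK => ?_⟩, fun k q φ hφ ψ hψ L hL hLφ L' hL' hLψ => ?_⟩
  · simpa only [metricDist_comm h (v _ _)] using hh K hK
  · obtain ⟨ε₁, hε₁, C, hC, h⟩ := h2 k q φ hφ ψ hψ L hL hLφ L' hL' hLψ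
    refine ⟨ε₁, hε₁, C, hC, fun ε hε p hp hpL hpL' => ?_⟩
    have := h ε hε p hp hpL' hpL
    rw [← norm_neg, ← iteratedFDeriv_neg_apply] at this
    simpa only [Pi.neg_def, neg_sub] using this

theorem IsCBounded.isEquivalent_refl [IsManifold (𝓡 m) ∞ Y] [T2Space Y] [ParacompactSpace Y]
    (hu : IsCBounded u) : IsEquivalent u u := by
  refine isEquivalent_of_exists_bound hu
    (fun K _ A O _ _ hAO => .of_forall fun ε p _ hp => hAO hp)
    fun k q φ _ ψ _ L _ _ L' _ _ => ⟨0, .of_forall fun ε p _ _ _ => ?_⟩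
  simp [← Pi.zero_def]

theorem IsEquivalent.trans [IsManifold (𝓡 n) ∞ X] [IsManifold (𝓡 m) ∞ Y] [T2Space Y]
    [ParacompactSpace Y] (hu : IsCBounded u)
    (huv : IsEquivalent u v) (hvw : IsEquivalent v w) : IsEquivalent u w := by
  have : LocallyCompactSpace Y := ChartedSpace.locallyCompactSpace (EuclideanSpace ℝ (Fin m)) Y
  refine isEquivalent_of_exists_bound hu (huv.compactlyClose.trans hvw.compactlyClose)
    fun k q φ hφ ψ hψ L hL hLφ L' hL' hLψ => ?_
  obtain ⟨B, hB, hLB, hBψ⟩ := exists_compact_between hL' ψ.open_source hLψ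
  obtain ⟨a, ha⟩ := huv.exists_bound k q hφ hψ hL hLφ hB hBψ
  obtain ⟨b, hb⟩ := hvw.exists_bound k q hφ hψ hL hLφ hB hBψ
  refine ⟨a + b, ?_⟩
  filter_upwards [ha, hb, huv.compactlyClose L hL L' _ hL' isOpen_interior hLB]
    with ε h1 h2 h3 p hp hpu hpw
  have hpu' := interior_subset (hLB hpu)
  have hpw' := interior_subset (hLB hpw)
  have hpv' := interior_subset (h3 p hp hpu)
  have hle : ((k : ℕ) : WithTop ℕ∞) ≤ (∞ : WithTop ℕ∞) := by exact_mod_cast le_top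
  have cu := (contDiffAt_chart_expression hφ hψ (u ε) (hLφ hp) (hBψ hpu')).of_le hle
  have cv := (contDiffAt_chart_expression hφ hψ (v ε) (hLφ hp) (hBψ hpv')).of_le hle
  have cw := (contDiffAt_chart_expression hφ hψ (w ε) (hLφ hp) (hBψ hpw')).of_le hle
  have hsplit : (fun x => ψ (u ε (φ.symm x)) - ψ (w ε (φ.symm x))) = fun x =>
      (ψ (u ε (φ.symm x)) - ψ (v ε (φ.symm x))) + (ψ (v ε (φ.symm x)) - ψ (w ε (φ.symm x))) := by
    ext1 x
    abel
  rw [hsplit, fun_iteratedFDeriv_add_apply (cu.sub cv) (cv.sub cw)]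
  refine (norm_add_le _ _).trans ?_
  push_cast
  rw [add_mul]
  exact add_le_add (h1 k le_rfl p hp hpu' hpv') (h2 k le_rfl p hp hpv' hpw')

end NormalForms

end Colombeau

namespace Colombeau

open Set Filter

variable {n m l : ℕ}
  {X : Type*} [TopologicalSpace X] [ChartedSpace (EuclideanSpace ℝ (Fin n)) X]
  {Y : Type*} [TopologicalSpace Y] [ChartedSpace (EuclideanSpace ℝ (Fin m)) Y]
  {Z : Type*} [TopologicalSpace Z] [ChartedSpace (EuclideanSpace ℝ (Fin l)) Z]
  {u u' : SmoothNet n m X Y} {v v' : SmoothNet m l Y Z}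

theorem IsCBounded.compNet (hv : IsCBounded v) (hu : IsCBounded u) :
    IsCBounded (compNet v u) := by
  intro K hK
  obtain ⟨ε₁, hε₁, K', hK', h1⟩ := hu K hK
  obtain ⟨ε₂, hε₂, K'', hK'', h2⟩ := hv K' hK'
  refine ⟨min ε₁ ε₂, lt_min hε₁ hε₂, K'', hK'', fun ε hε => ?_⟩
  rintro _ ⟨p, hp, rfl⟩
  exact h2 ε (hε.trans_le (min_le_right _ _))
    ⟨u ε p, h1 ε (hε.trans_le (min_le_left _ _)) ⟨p, hp, rfl⟩, rfl⟩

theorem CompactlyClose.compNet_left (hv : CompactlyClose v v') (hu : IsCBounded u) :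
    CompactlyClose (compNet v u) (compNet v' u) := by
  intro K hK A O hA hO hAO
  obtain ⟨ε₁, hε₁, K', hK', h1⟩ := hu K hK
  filter_upwards [eventually_smallParam_iff.2 ⟨ε₁, hε₁, h1⟩, hv K' hK' A O hA hO hAO]
    with ε h1 h2 p hp hpA
  exact h2 _ (h1 ⟨p, hp, rfl⟩) hpA

/-- Near `p`, a chart expression of a composition is the composition of chart expressions. -/
theorem chart_expression_comp_eventuallyEq {φ : OpenPartialHomeomorph X (EuclideanSpace ℝ (Fin n))}
    {ψ : OpenPartialHomeomorph Y (EuclideanSpace ℝ (Fin m))} {F : Type*} (g : Y → F)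
    (f : ContMDiffMap (𝓡 n) (𝓡 m) X Y ∞) {p : X} (hp : p ∈ φ.source) (hfp : f p ∈ ψ.source) :
    (fun x => g (f (φ.symm x))) =ᶠ[𝓝 (φ p)] fun x => g (ψ.symm (ψ (f (φ.symm x)))) := by
  filter_upwards [eventually_apply_symm_mem_source f hp hfp] with x hx
  rw [ψ.left_inv hx]

variable [IsManifold (𝓡 n) ∞ X] [IsManifold (𝓡 m) ∞ Y] [IsManifold (𝓡 l) ∞ Z]

theorem IsModerate.compNet (hv : IsModerate v) (hu : IsModerate u) :
    IsModerate (compNet v u) := by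
  refine isModerate_of_exists_growth (hv.1.compNet hu.1)
    fun k hk φ hφ χ hχ L hL hLφ L' hL' hLχ => ?_
  refine hu.1.eventually_of_local hL (Q := fun a ε p => v ε (u ε p) ∈ L' →
    ‖iteratedFDeriv ℝ k (fun x => χ (v ε (u ε (φ.symm x)))) (φ p)‖ ≤ growth a ε)
    (fun a b ε p hab h hp => (h hp).trans (growth_mono hab ε)) fun y => ?_
  obtain ⟨ψ, hψ, A, O, B, hyA, hA, -, hAO, hOB, -, hBψ, -⟩ :=
    exists_convex_chart_neighborhoods (m := m) y
  have hAψ := hAO.trans (hOB.trans hBψ)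
  obtain ⟨a, ha⟩ := hu.exists_growth k hφ hψ hL hLφ hA hAψ
  obtain ⟨b, hb⟩ := hv.exists_growth k hψ hχ hA hAψ hL' hLχ
  obtain ⟨C, hC⟩ := (hL'.image_of_continuousOn (χ.continuousOn.mono hLχ)).isBounded.exists_norm_le
  obtain ⟨c, hc⟩ := exists_growth_ge k.factorial a (max b ⌈C⌉₊) k
  refine ⟨A, hyA, c, ?_⟩
  filter_upwards [ha, hb] with ε h1 h2 p hp hpA hpL
  refine le_trans ?_ (hc ε)
  have hle : ((k : ℕ) : WithTop ℕ∞) ≤ (∞ : WithTop ℕ∞) := by exact_mod_cast le_top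
  have hpφ : φ.symm (φ p) = p := φ.left_inv (hLφ hp)
  have hpψ : ψ.symm (ψ (u ε p)) = u ε p := ψ.left_inv (hAψ hpA)
  rw [((chart_expression_comp_eventuallyEq (fun z => χ (v ε z)) (u ε) (hLφ hp)
    (hAψ hpA)).iteratedFDeriv ℝ k).eq_of_nhds]
  refine norm_iteratedFDeriv_comp_le_of_bound (g := fun x => χ (v ε (ψ.symm x)))
    (f := fun x => ψ (u ε (φ.symm x))) ?_
    ((contDiffAt_chart_expression hφ hψ (u ε) (hLφ hp) (hAψ hpA)).of_le hle)
    (one_le_growth a ε) (fun i hi => ?_) (fun i hi1 hi => h1 i hi hi1 p hp hpA)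
  · rw [hpφ]
    exact (contDiffAt_chart_expression hψ hχ (v ε) (hAψ hpA) (hLχ hpL)).of_le hle
  · rw [hpφ]
    rcases Nat.eq_zero_or_pos i with rfl | hi1
    · rw [norm_iteratedFDeriv_zero, hpψ]
      have h3 : C ≤ (max b ⌈C⌉₊ : ℕ) :=
        (Nat.le_ceil C).trans (by exact_mod_cast le_max_right _ _)
      have h4 := natCast_add_one_le_growth (max b ⌈C⌉₊) ε
      have h5 := hC _ (mem_image_of_mem χ hpL)
      linarith
    · exact (h2 i hi hi1 _ hpA hpL).trans (growth_mono (le_max_left _ _) ε)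

theorem IsEquivalent.compNet_left [T2Space Z] [ParacompactSpace Z] (hvv' : IsEquivalent v v')
    (hv : IsCBounded v) (hu : IsModerate u) :
    IsEquivalent (compNet v u) (compNet v' u) := by
  have : LocallyCompactSpace Z := ChartedSpace.locallyCompactSpace (EuclideanSpace ℝ (Fin l)) Z
  refine isEquivalent_of_exists_bound (hv.compNet hu.1) (hvv'.compactlyClose.compNet_left hu.1)
    fun k q φ hφ χ hχ L hL hLφ L' hL' hLχ => ?_
  refine hu.1.eventually_of_local hL (Q := fun (a : ℕ) ε p => v ε (u ε p) ∈ L' →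
    v' ε (u ε p) ∈ L' →
    ‖iteratedFDeriv ℝ k (fun x => χ (v ε (u ε (φ.symm x))) - χ (v' ε (u ε (φ.symm x)))) (φ p)‖ ≤
      a * (ε : ℝ) ^ q)
    (fun a b ε p hab h hp hp' => (h hp hp').trans (mul_le_mul_of_nonneg_right
      (by exact_mod_cast hab) (pow_nonneg ε.2.1.le q))) fun y => ?_
  obtain ⟨ψ, hψ, A, O, B, hyA, hA, -, hAO, hOB, -, hBψ, -⟩ :=
    exists_convex_chart_neighborhoods (m := m) y
  have hAψ := hAO.trans (hOB.trans hBψ)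
  obtain ⟨a, ha⟩ := hu.exists_growth k hφ hψ hL hLφ hA hAψ
  obtain ⟨b, hb⟩ := hvv'.exists_bound k (q + a * k) hψ hχ hA hAψ hL' hLχ
  refine ⟨A, hyA, k.factorial * b * (a + 1) ^ k, ?_⟩
  filter_upwards [ha, hb] with ε h1 h2 p hp hpA hpL hpL'
  have hle : ((k : ℕ) : WithTop ℕ∞) ≤ (∞ : WithTop ℕ∞) := by exact_mod_cast le_top
  have hpφ : φ.symm (φ p) = p := φ.left_inv (hLφ hp)
  rw [((chart_expression_comp_eventuallyEq (fun z => χ (v ε z) - χ (v' ε z)) (u ε) (hLφ hp)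
    (hAψ hpA)).iteratedFDeriv ℝ k).eq_of_nhds]
  refine (norm_iteratedFDeriv_comp_le_of_bound
    (g := fun x => χ (v ε (ψ.symm x)) - χ (v' ε (ψ.symm x)))
    (f := fun x => ψ (u ε (φ.symm x))) ?_
    ((contDiffAt_chart_expression hφ hψ (u ε) (hLφ hp) (hAψ hpA)).of_le hle)
    (one_le_growth a ε) (C := b * (ε : ℝ) ^ (q + a * k)) (fun i hi => ?_)
    (fun i hi1 hi => h1 i hi hi1 p hp hpA)).trans_eq ?_
  · rw [hpφ]
    exact ((contDiffAt_chart_expression hψ hχ (v ε) (hAψ hpA) (hLχ hpL)).sub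
      (contDiffAt_chart_expression hψ hχ (v' ε) (hAψ hpA) (hLχ hpL'))).of_le hle
  · rw [hpφ]
    exact h2 i hi _ hpA hpL hpL'
  · have := growth_pow_mul_pow a k q ε
    push_cast
    linear_combination (k.factorial * b : ℝ) * this

/-- Equicontinuity at polynomial scales of a moderate net with images in single charts. -/
theorem IsModerate.exists_pow_equicontinuous (hv : IsModerate v) (hv' : HasSingleChartImages v)
    {ψ : OpenPartialHomeomorph Y (EuclideanSpace ℝ (Fin m))} (hψ : ψ ∈ SmoothCharts m Y)
    {B : Set Y} (hB : IsCompact B) (hBψ : B ⊆ ψ.source) (hconv : Convex ℝ (ψ '' B))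
    {A O : Set Z} (hA : IsCompact A) (hO : IsOpen O) (hAO : A ⊆ O) :
    ∃ a : ℕ, ∀ᶠ ε : ParamInterval in smallParam, ∀ z ∈ B, ∀ z' ∈ B, ‖ψ z' - ψ z‖ ≤ (ε : ℝ) ^ a →
      v ε z ∈ A → v ε z' ∈ O := by
  obtain ⟨ε₀, hε₀, χ, hχ, hcpt, hsub⟩ := hv' B hB
  set T := closure (⋃ ε : {ε : ParamInterval // (ε : ℝ) < ε₀}, v ε.1 '' B)
  obtain ⟨a, ha⟩ := hv.exists_growth 1 hψ hχ hB hBψ hcpt hsub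
  have hAT : IsCompact (A ∩ T) := hA.inter_right isClosed_closure
  obtain ⟨δ, hδ, hδO⟩ := (hAT.image_of_continuousOn
    (χ.continuousOn.mono (inter_subset_right.trans hsub))).exists_thickening_subset_open
    (χ.symm.isOpen_inter_preimage hO) (by
      rintro _ ⟨z, ⟨hzA, hzT⟩, rfl⟩
      refine ⟨χ.map_source (hsub hzT), ?_⟩
      rw [mem_preimage, χ.left_inv (hsub hzT)]
      exact hAO hzA)
  refine ⟨a + 1, ?_⟩
  filter_upwards [ha, eventually_mul_lt (a + 1) hδ,
    eventually_smallParam_iff.2 ⟨ε₀, hε₀, fun _ h => h⟩] with ε h1 h2 h3 z hz z' hz' hzz' hzA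
  have hT : ∀ z ∈ B, v ε z ∈ T := fun z hz =>
    subset_closure (mem_iUnion.2 ⟨⟨ε, h3⟩, z, hz, rfl⟩)
  have hmv := hconv.norm_image_sub_le_of_norm_fderiv_le (𝕜 := ℝ)
    (f := fun x => χ (v ε (ψ.symm x))) (C := growth a ε) (by
      rintro _ ⟨s, hs, rfl⟩
      exact (contDiffAt_chart_expression hψ hχ (v ε) (hBψ hs)
        (hsub (hT s hs))).differentiableAt (by simp)) (by
      rintro _ ⟨s, hs, rfl⟩
      have := h1 1 le_rfl le_rfl s hs (hT s hs)
      rwa [norm_iteratedFDeriv_one] at this) (mem_image_of_mem ψ hz) (mem_image_of_mem ψ hz')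
  rw [ψ.left_inv (hBψ hz), ψ.left_inv (hBψ hz')] at hmv
  have hlt : dist (χ (v ε z')) (χ (v ε z)) < δ := by
    rw [dist_eq_norm]
    refine hmv.trans_lt (lt_of_le_of_lt ?_ h2)
    have h0 : growth a ε * (ε : ℝ) ^ (a + 1) = (a + 1) * ε := by
      have := growth_pow_mul_pow a 1 1 ε
      rw [pow_one, pow_one, pow_one, mul_one, add_comm 1 a] at this
      exact this
    rw [← h0]
    have := zero_le_one.trans (one_le_growth a ε)
    gcongr
  have hmem := hδO (Metric.mem_thickening_iff.2
    ⟨_, mem_image_of_mem χ ⟨hzA, hT z hz⟩, hlt⟩)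
  have := hmem.2
  rwa [mem_preimage, χ.left_inv (hsub (hT z' hz'))] at this

/-- Zeroth order estimate for equivalent nets over an arbitrary compact set. -/
theorem IsEquivalent.exists_norm_sub_le (huu' : IsEquivalent u u') (q : ℕ)
    {ψ : OpenPartialHomeomorph Y (EuclideanSpace ℝ (Fin m))} (hψ : ψ ∈ SmoothCharts m Y)
    {K : Set X} (hK : IsCompact K) {B : Set Y} (hB : IsCompact B) (hBψ : B ⊆ ψ.source) :
    ∃ a : ℕ, ∀ᶠ ε : ParamInterval in smallParam, ∀ p ∈ K, u ε p ∈ B → u' ε p ∈ B →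
      ‖ψ (u ε p) - ψ (u' ε p)‖ ≤ a * (ε : ℝ) ^ q := by
  refine hK.induction_on (p := fun K => ∃ a : ℕ, ∀ᶠ ε : ParamInterval in smallParam, ∀ p ∈ K, u ε p ∈ B →
    u' ε p ∈ B → ‖ψ (u ε p) - ψ (u' ε p)‖ ≤ a * (ε : ℝ) ^ q) ⟨0, by simp⟩ ?_ ?_ ?_
  · rintro K K' hKK' ⟨a, ha⟩
    exact ⟨a, ha.mono fun ε h p hp => h p (hKK' hp)⟩
  · rintro K K' ⟨a, ha⟩ ⟨b, hb⟩
    refine ⟨a + b, ?_⟩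
    filter_upwards [ha, hb] with ε h1 h2 p hp hpu hpu'
    have h0 := pow_nonneg ε.2.1.le q
    push_cast
    rw [add_mul]
    rcases hp with hp | hp
    · have := h1 p hp hpu hpu'
      have : 0 ≤ b * (ε : ℝ) ^ q := by positivity
      linarith
    · have := h2 p hp hpu hpu'
      have : 0 ≤ a * (ε : ℝ) ^ q := by positivity
      linarith
  · intro x _
    obtain ⟨φ, hφ, A, O, C, hxA, hA, -, hAO, hOB, -, hBφ, -⟩ :=
      exists_convex_chart_neighborhoods (m := n) x
    have hAφ := hAO.trans (hOB.trans hBφ)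
    obtain ⟨a, ha⟩ := huu'.exists_bound 0 q hφ hψ hA hAφ hB hBψ
    refine ⟨A, mem_nhdsWithin_of_mem_nhds hxA, a, ha.mono fun ε h p hp hpu hpu' => ?_⟩
    have := h 0 le_rfl p hp hpu hpu'
    rwa [norm_iteratedFDeriv_zero, φ.left_inv (hAφ hp)] at this

/-- In a chart, equivalent nets are eventually closer than any power of `ε`. -/
theorem IsEquivalent.eventually_norm_sub_le (huu' : IsEquivalent u u') (q : ℕ)
    {ψ : OpenPartialHomeomorph Y (EuclideanSpace ℝ (Fin m))} (hψ : ψ ∈ SmoothCharts m Y)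
    {K : Set X} (hK : IsCompact K) {B : Set Y} (hB : IsCompact B) (hBψ : B ⊆ ψ.source) :
    ∀ᶠ ε : ParamInterval in smallParam, ∀ p ∈ K, u ε p ∈ B → u' ε p ∈ B →
      ‖ψ (u' ε p) - ψ (u ε p)‖ ≤ (ε : ℝ) ^ q := by
  obtain ⟨a, ha⟩ := huu'.exists_norm_sub_le (q + 1) hψ hK hB hBψ
  filter_upwards [ha, eventually_mul_lt a one_pos] with ε h1 h2 p hp hpu hpu'
  rw [norm_sub_rev]
  refine (h1 p hp hpu hpu').trans ?_
  have h0 := pow_nonneg ε.2.1.le q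
  calc a * (ε : ℝ) ^ (q + 1) = (a * ε) * (ε : ℝ) ^ q := by ring
    _ ≤ 1 * (ε : ℝ) ^ q := by gcongr
    _ = _ := one_mul _

theorem CompactlyClose.compNet_right [T2Space Y] (hv : IsModerate v)
    (hv' : HasSingleChartImages v) (hu : IsCBounded u) (huu' : IsEquivalent u u') :
    CompactlyClose (compNet v u) (compNet v u') := by
  have : LocallyCompactSpace Y := ChartedSpace.locallyCompactSpace (EuclideanSpace ℝ (Fin m)) Y
  intro K hK A' O' hA' hO' hAO'
  obtain ⟨-, h⟩ := hu.eventually_of_local hK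
    (Q := fun _ ε p => v ε (u ε p) ∈ A' → v ε (u' ε p) ∈ O') (fun _ _ _ _ _ h => h) fun y => by
      obtain ⟨ψ, hψ, A, O, B, hyA, hA, hO, hAO, hOB, hB, hBψ, hconv⟩ :=
        exists_convex_chart_neighborhoods (m := m) y
      obtain ⟨a, ha⟩ := hv.exists_pow_equicontinuous hv' hψ hB hBψ hconv hA' hO' hAO'
      refine ⟨A, hyA, 0, ?_⟩
      filter_upwards [ha, huu'.eventually_norm_sub_le a hψ hK hB hBψ,
        huu'.compactlyClose K hK A O hA hO hAO] with ε h1 h2 h3 p hp hpA hpA'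
      have hpB := hOB (hAO hpA)
      have hpB' := hOB (h3 p hp hpA)
      exact h1 _ hpB _ hpB' (h2 p hp hpB hpB') hpA'
  exact h

theorem IsEquivalent.compNet_right [T2Space Y] [T2Space Z] [ParacompactSpace Z]
    (hv : IsModerate v) (hv' : HasSingleChartImages v) (hu : IsModerate u) (hu' : IsModerate u')
    (huu' : IsEquivalent u u') : IsEquivalent (compNet v u) (compNet v u') := by
  have : LocallyCompactSpace Y := ChartedSpace.locallyCompactSpace (EuclideanSpace ℝ (Fin m)) Y
  have : LocallyCompactSpace Z := ChartedSpace.locallyCompactSpace (EuclideanSpace ℝ (Fin l)) Z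
  refine isEquivalent_of_exists_bound (hv.1.compNet hu.1)
    (CompactlyClose.compNet_right hv hv' hu.1 huu')
    fun k q φ hφ χ hχ L hL hLφ L' hL' hLχ => ?_
  obtain ⟨L₂, hL₂, hLL₂, hL₂χ⟩ := exists_compact_between hL' χ.open_source hLχ
  refine hu.1.eventually_of_local hL (Q := fun (a : ℕ) ε p => v ε (u ε p) ∈ L' →
    v ε (u' ε p) ∈ L' →
    ‖iteratedFDeriv ℝ k (fun x => χ (v ε (u ε (φ.symm x))) - χ (v ε (u' ε (φ.symm x)))) (φ p)‖ ≤
      a * (ε : ℝ) ^ q)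
    (fun a b ε p hab h hp hp' => (h hp hp').trans (mul_le_mul_of_nonneg_right
      (by exact_mod_cast hab) (pow_nonneg ε.2.1.le q))) fun y => ?_
  obtain ⟨ψ, hψ, A, O, B, hyA, hA, hO, hAO, hOB, hB, hBψ, hconv⟩ :=
    exists_convex_chart_neighborhoods (m := m) y
  obtain ⟨C, hC0, hC⟩ := exists_norm_iteratedFDeriv_comp_sub_comp_le
    (EuclideanSpace ℝ (Fin n)) (EuclideanSpace ℝ (Fin m)) k
  obtain ⟨e, he⟩ := hv.exists_pow_equicontinuous hv' hψ hB hBψ hconv hL' isOpen_interior hLL₂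
  obtain ⟨a₁, ha₁⟩ := hu.exists_growth k hφ hψ hL hLφ hB hBψ
  obtain ⟨a₂, ha₂⟩ := hu'.exists_growth k hφ hψ hL hLφ hB hBψ
  obtain ⟨a₃, ha₃⟩ := hv.exists_growth (k + 1) hψ hχ hB hBψ hL₂ hL₂χ
  set a := max a₁ (max a₂ a₃) with hadef
  obtain ⟨b, hb⟩ := huu'.exists_bound k (q + a * (k + 1)) hφ hψ hL hLφ hB hBψ
  refine ⟨A, hyA, ⌈C⌉₊ * (a + 1) ^ (k + 1) * b, ?_⟩
  filter_upwards [he, ha₁, ha₂, ha₃, hb, huu'.eventually_norm_sub_le e hψ hL hB hBψ,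
    huu'.compactlyClose L hL A O hA hO hAO] with ε h1 h2 h3 h4 h5 h6 h7 p hp hpA hpL hpL'
  have hpB := hOB (hAO hpA)
  have hpB' := hOB (h7 p hp hpA)
  have hpφ : φ.symm (φ p) = p := φ.left_inv (hLφ hp)
  have heq : (fun x => χ (v ε (u ε (φ.symm x))) - χ (v ε (u' ε (φ.symm x)))) =ᶠ[𝓝 (φ p)]
      fun x => χ (v ε (ψ.symm (ψ (u ε (φ.symm x))))) - χ (v ε (ψ.symm (ψ (u' ε (φ.symm x))))) :=
    (chart_expression_comp_eventuallyEq (fun z => χ (v ε z)) (u ε) (hLφ hp) (hBψ hpB)).sub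
      (chart_expression_comp_eventuallyEq (fun z => χ (v ε z)) (u' ε) (hLφ hp) (hBψ hpB'))
  have hseg : ∀ s ∈ segment ℝ (ψ (u ε (φ.symm (φ p)))) (ψ (u' ε (φ.symm (φ p)))),
      ∃ z ∈ B, ψ z = s ∧ v ε z ∈ L₂ := by
    rw [hpφ]
    intro s hs
    obtain ⟨z, hz, rfl⟩ := hconv.segment_subset (mem_image_of_mem ψ hpB)
      (mem_image_of_mem ψ hpB') hs
    refine ⟨z, hz, rfl, interior_subset (h1 _ hpB z hz ?_ hpL)⟩
    exact (norm_sub_le_of_mem_segment hs).trans (h6 p hp hpB hpB')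
  rw [(heq.iteratedFDeriv ℝ k).eq_of_nhds]
  have h0 : 0 ≤ (ε : ℝ) := ε.2.1.le
  refine (hC (EuclideanSpace ℝ (Fin l)) (fun x => χ (v ε (ψ.symm x)))
    (fun x => ψ (u ε (φ.symm x))) (fun x => ψ (u' ε (φ.symm x))) (φ p) (growth a ε)
    (b * (ε : ℝ) ^ (q + a * (k + 1))) (one_le_growth a ε) (by positivity) ?_
    (contDiffAt_chart_expression hφ hψ (u ε) (hLφ hp) (hBψ hpB))
    (contDiffAt_chart_expression hφ hψ (u' ε) (hLφ hp) (hBψ hpB')) ?_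
    (fun i hi1 hi => (h2 i hi hi1 p hp hpB).trans (growth_mono (by omega) ε))
    (fun i hi1 hi => (h3 i hi hi1 p hp hpB').trans (growth_mono (by omega) ε))
    (fun i hi => h5 i hi p hp hpB hpB') k le_rfl).trans ?_
  · intro s hs
    obtain ⟨z, hz, rfl, hzL⟩ := hseg s hs
    exact contDiffAt_chart_expression hψ hχ (v ε) (hBψ hz) (hL₂χ hzL)
  · intro j hj1 hj s hs
    obtain ⟨z, hz, rfl, hzL⟩ := hseg s hs
    exact (h4 j hj hj1 z hz hzL).trans (growth_mono (by omega) ε)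
  · have := growth_pow_mul_pow a (k + 1) q ε
    calc C * growth a ε ^ (k + 1) * (b * (ε : ℝ) ^ (q + a * (k + 1)))
        = C * ((a + 1) ^ (k + 1) * (ε : ℝ) ^ q * b) := by rw [← this]; ring
      _ ≤ ⌈C⌉₊ * ((a + 1) ^ (k + 1) * (ε : ℝ) ^ q * b) := by
          gcongr
          exact Nat.le_ceil C
      _ = _ := by push_cast; ring

theorem GenMap.isEquivalent_of_cl_eq [T2Space Y] [ParacompactSpace Y] {u u' : ModerateNet n m X Y}
    (h : GenMap.cl u = GenMap.cl u') : IsEquivalent u.1 u'.1 := by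
  have hequiv : Equivalence fun u v : ModerateNet n m X Y => IsEquivalent u.1 v.1 :=
    ⟨fun u => u.2.1.isEquivalent_refl, fun h => h.symm, fun {x _ _} h1 h2 => h1.trans x.2.1 h2⟩
  exact hequiv.eqvGen_iff.1 (Quot.eqvGen_exact h)

theorem GenMap.isEquivalent_compNet [T2Space Y] [ParacompactSpace Y] [T2Space Z]
    [ParacompactSpace Z] {v₀ : ModerateNet m l Y Z} (hv₀ : HasSingleChartImages v₀.1)
    {u u' : ModerateNet n m X Y} {v v' : ModerateNet m l Y Z}
    (hu : GenMap.cl u = GenMap.cl u') (hv : GenMap.cl v = GenMap.cl v₀)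
    (hv' : GenMap.cl v' = GenMap.cl v₀) :
    IsEquivalent (Colombeau.compNet v.1 u.1) (Colombeau.compNet v'.1 u'.1) := by
  have h1 := (isEquivalent_of_cl_eq hv).compNet_left v.2.1 u.2
  have h2 := IsEquivalent.compNet_right v₀.2 hv₀ u.2 u'.2 (isEquivalent_of_cl_eq hu)
  have h3 := ((isEquivalent_of_cl_eq hv').compNet_left v'.2.1 u'.2).symm
  exact (h1.trans (v.2.1.compNet u.2.1) h2).trans (v.2.1.compNet u.2.1) h3

end Colombeau

theorem mainTheorem4 {n m l : ℕ}
    {X : Type*} [TopologicalSpace X] [T2Space X] [ParacompactSpace X]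
    [ChartedSpace (EuclideanSpace ℝ (Fin n)) X] [IsManifold (𝓡 n) ∞ X]
    {Y : Type*} [TopologicalSpace Y] [T2Space Y] [ParacompactSpace Y]
    [ChartedSpace (EuclideanSpace ℝ (Fin m)) Y] [IsManifold (𝓡 m) ∞ Y]
    {Z : Type*} [TopologicalSpace Z] [T2Space Z] [ParacompactSpace Z]
    [ChartedSpace (EuclideanSpace ℝ (Fin l)) Z] [IsManifold (𝓡 l) ∞ Z]
    (U : Colombeau.GenMap n m X Y) (V : Colombeau.GenMap m l Y Z)
    (hV : ∃ v : Colombeau.ModerateNet m l Y Z,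
      Colombeau.GenMap.cl v = V ∧ Colombeau.HasSingleChartImages v.1) :
    (∃! W : Colombeau.GenMap n l X Z,
      ∀ (u : Colombeau.ModerateNet n m X Y) (v : Colombeau.ModerateNet m l Y Z),
        Colombeau.GenMap.cl u = U → Colombeau.GenMap.cl v = V →
          ∃ hmod : Colombeau.IsModerate (Colombeau.compNet v.1 u.1),
            Colombeau.GenMap.cl ⟨Colombeau.compNet v.1 u.1, hmod⟩ = W) ∧
    (∀ (u u' : Colombeau.ModerateNet n m X Y) (v v' : Colombeau.ModerateNet m l Y Z),
      Colombeau.GenMap.cl u = U → Colombeau.GenMap.cl u' = U →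
      Colombeau.GenMap.cl v = V → Colombeau.GenMap.cl v' = V →
        Colombeau.IsEquivalent (Colombeau.compNet v.1 u.1) (Colombeau.compNet v'.1 u'.1)) := by
  obtain ⟨v₀, hv₀, hv₀'⟩ := hV
  have hequiv : ∀ (u u' : Colombeau.ModerateNet n m X Y) (v v' : Colombeau.ModerateNet m l Y Z),
      Colombeau.GenMap.cl u = U → Colombeau.GenMap.cl u' = U →
      Colombeau.GenMap.cl v = V → Colombeau.GenMap.cl v' = V →
        Colombeau.IsEquivalent (Colombeau.compNet v.1 u.1) (Colombeau.compNet v'.1 u'.1) :=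
    fun u u' v v' hu hu' hv hv' => Colombeau.GenMap.isEquivalent_compNet hv₀'
      (hu.trans hu'.symm) (hv.trans hv₀.symm) (hv'.trans hv₀.symm)
  refine ⟨?_, hequiv⟩
  obtain ⟨u₀, hu₀⟩ : ∃ u₀ : Colombeau.ModerateNet n m X Y, Colombeau.GenMap.cl u₀ = U :=
    Quot.exists_rep U
  refine ⟨Colombeau.GenMap.cl ⟨Colombeau.compNet v₀.1 u₀.1, v₀.2.compNet u₀.2⟩,
    fun u v hu hv => ⟨v.2.compNet u.2, Quot.sound (hequiv u u₀ v v₀ hu hu₀ hv hv₀)⟩,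
    fun W hW => ?_⟩
  obtain ⟨_, h⟩ := hW u₀ v₀ hu₀ hv₀
  exact h.symm
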